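/- For every $m\ge 1$ let $p_{1,m},\dots,p_{m,m}$ be $[0,1]$-valued random variables ($p$-values) on a probability space $(\Omega_m,\mathcal A_m,P_m)$, and let $\{1,\dots,m\}=I_{0,m}\cup I_{1,m}$ be a nonrandom disjoint decomposition into true and false nulls, with $m_0=\#I_{0,m}$. Assume that $(p_{i,m})_{i\in I_{0,m}}$ are independent and uniformly distributed on $[0,1]$ and that the vector $(p_{i,m})_{i\in I_{0,m}}$ is independent of the vector $(p_{i,m})_{i\in I_{1,m}}$, whose joint distribution is arbitrary. Let $\widehat F_m$ be the empirical distribution function of $p_{1,m},\dots,p_{m,m}$, and put $R_m(t)=m\widehat F_m(t)$. Fix $0<\alpha\le\lambda<1$, and let $\widehat m_0=\widehat m_0((\widehat F_m(t))_{t\ge\lambda})>0$ be an estimator of $m_0$ that is a measurable function of $(\widehat F_m(t))_{t\ge\lambda}$. The adaptive step-up test has critical values $\widehat\alpha_{i:m}=\min\{i\alpha/\widehat m_0,\lambda\}$, $0\le i\le m$. With the ordered $p$-values $p_{1:m}\le\dots\le p_{m:m}$ and $p_{0:m}:=0$, its number of rejections is $R_m=\max\{0\le i\le m: p_{i:m}\le\widehat\alpha_{i:m}\}$.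 It rejects the $i$-th null if and only if $p_{i,m}\le\widehat\alpha_{R_m:m}$, and $V_m=\#\{i\in I_{0,m}:p_{i,m}\le\widehat\alpha_{R_m:m}\}$ is the number of false rejections. We use the convention $0/0=0$. Let $R_m^{(1,\lambda)}$ be the number of rejections of the same test applied to the vector obtained from $(p_{1,m},\dots,p_{m,m})$ by replacing with $0$ the $p$-value $p_{i,m}$ with the smallest index $i\in I_{0,m}$ such that $p_{i,m}\le\lambda$ (no replacement is made if there is no such $i$). Assume (A1) $m_0/m\to\kappa_0$ as $m\to\infty$ for some $\kappa_0\in(0,1]$; (A2) $\frac{\lambda}{\alpha}\widehat m_0\ge R_m(\lambda)$ for all $m\ge 1$; (A3) there is some $K>0$ with $\widehat m_0\le Km$ for all $m\ge 1$. Then the following are equivalent (limits as $m\to\infty$): (a) $\dfrac{V_m}{R_m}-\mathbb E\Bigl(\dfrac{V_m}{R_m}\Bigr)\to 0$ in $P_m$-probability; (b) $\dfrac{\widehat m_0}{m}-\mathbb E\Bigl(\dfrac{\widehat m_0}{m}\Bigr)\to 0$ in $P_m$-probability, and $R_m^{(1,\lambda)}\to\infty$ in $P_m$-probability, i.e. $P_m(R_m^{(1,\lambda)}\le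 C)\to0$ for every $C\in\mathbb R$. -/

import Mathlib

open MeasureTheory ProbabilityTheory Filter Topology

namespace MultipleTesting

noncomputable section

/-- The basic independence model for `m` p-values `p i`, `i : Fin m`, on a probability space, where
`I₀` is the set of true nulls and its complement the set of false nulls. No condition is put on
the joint law of the p-values of the false nulls. -/
structure BasicIndependence {Ω : Type*} [MeasurableSpace Ω] (P : Measure Ω) {m : ℕ}
    (I₀ : Finset (Fin m)) (p : Fin m → Ω → ℝ) : Prop where
  measurable : ∀ i, Measurable (p i)
  mem_Icc : ∀ i ω, p i ω ∈ Set.Icc (0 : ℝ) 1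
  indep_null_alt :
    IndepFun (fun ω (i : {i // i ∈ I₀}) => p i ω) (fun ω (i : {i // i ∉ I₀}) => p i ω) P
  indep_null : iIndepFun (fun (i : {i // i ∈ I₀}) => p i) P
  uniform_null : ∀ i ∈ I₀, ∀ x ∈ Set.Icc (0 : ℝ) 1, P {ω | p i ω ≤ x} = ENNReal.ofReal x

variable {m : ℕ}

/-- Empirical distribution function of `x₁, …, x_m`. -/
def ecdf (x : Fin m → ℝ) (t : ℝ) : ℝ :=
  ((Finset.univ.filter (fun i => x i ≤ t)).card : ℝ) / m

/-- The restriction `(F̂_m(t))_{t ≥ lam}` of the empirical distribution function. -/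
def ecdfTail (lam : ℝ) (x : Fin m → ℝ) : Set.Ici lam → ℝ :=
  fun t => ecdf x t

/-- `R_m(t) = m F̂_m(t)`. -/
def countLE (x : Fin m → ℝ) (t : ℝ) : ℝ := m * ecdf x t

/-- The order statistic `x_{i:m}` for `1 ≤ i ≤ m`, with `x_{0:m} = 0`
(the value `0` for `i > m` is never used). -/
def orderStat (x : Fin m → ℝ) (i : ℕ) : ℝ :=
  if h : 1 ≤ i ∧ i ≤ m then x (Tuple.sort x ⟨i - 1, by omega⟩) else 0

/-- Number of rejections `max {i = 0, …, m : x_{i:m} ≤ c_i}` of the step-up test with critical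
values `c`. -/
def stepUpRejections (c : ℕ → ℝ) (x : Fin m → ℝ) : ℕ :=
  Nat.findGreatest (fun i => orderStat x i ≤ c i) m

/-- Critical values `min {i α / m̂₀, lam}`. -/
def critValue (α lam m0hat : ℝ) (i : ℕ) : ℝ := min (i / m0hat * α) lam

/-- Data-driven critical values of the adaptive test with estimator
`m̂₀ = g ((F̂_m(t))_{t ≥ lam})`. -/
def adaptiveCrit (α lam : ℝ) (g : (Set.Ici lam → ℝ) → ℝ) (x : Fin m → ℝ) : ℕ → ℝ :=
  critValue α lam (g (ecdfTail lam x))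

/-- `R_m`, the number of rejections of the adaptive step-up test. -/
def rejections (α lam : ℝ) (g : (Set.Ici lam → ℝ) → ℝ) (x : Fin m → ℝ) : ℕ :=
  stepUpRejections (adaptiveCrit α lam g x) x

/-- `V_m`, the number of rejected true nulls; hypothesis `i` is rejected iff its p-value is at most
the `R_m`-th critical value. -/
def falseRejections (α lam : ℝ) (g : (Set.Ici lam → ℝ) → ℝ) (I₀ : Finset (Fin m))
    (x : Fin m → ℝ) : ℕ :=
  (I₀.filter (fun i => x i ≤ adaptiveCrit α lam g x (rejections α lam g x))).card

/-- The false discovery proportion `V_m / R_m`, with `0 / 0 = 0`. -/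
def FDP (α lam : ℝ) (g : (Set.Ici lam → ℝ) → ℝ) (I₀ : Finset (Fin m)) (x : Fin m → ℝ) : ℝ :=
  (falseRejections α lam g I₀ x : ℝ) / (rejections α lam g x : ℝ)

/-- The vector `x^{(1,lam)}`: the entry at the smallest true null `i` with `x i ≤ lam` is replaced
by `0`; nothing is changed if there is no such `i`. -/
def replaceOne (lam : ℝ) (I₀ : Finset (Fin m)) (x : Fin m → ℝ) : Fin m → ℝ :=
  if h : (I₀.filter (fun i => x i ≤ lam)).Nonempty then
    Function.update x ((I₀.filter (fun i => x i ≤ lam)).min' h) 0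
  else x

/-- `R_m^{(1,lam)}`, the number of rejections of the adaptive test applied to `x^{(1,lam)}`. -/
def rejectionsOne (α lam : ℝ) (g : (Set.Ici lam → ℝ) → ℝ) (I₀ : Finset (Fin m))
    (x : Fin m → ℝ) : ℕ :=
  rejections α lam g (replaceOne lam I₀ x)

/-- `X_m → 0` in `P_m`-probability; the probability space may vary with `m`. -/
def TendstoZeroInProb {Ω : ℕ → Type*} [∀ m, MeasurableSpace (Ω m)] (P : ∀ m, Measure (Ω m))
    (X : ∀ m, Ω m → ℝ) : Prop :=
  ∀ ε : ℝ, 0 < ε → Tendsto (fun m => P m {ω | ε ≤ |X m ω|}) atTop (𝓝 0)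

/-- `X_m → ∞` in `P_m`-probability. -/
def TendstoInftyInProb {Ω : ℕ → Type*} [∀ m, MeasurableSpace (Ω m)] (P : ∀ m, Measure (Ω m))
    (X : ∀ m, Ω m → ℝ) : Prop :=
  ∀ C : ℝ, Tendsto (fun m => P m {ω | X m ω ≤ C}) atTop (𝓝 0)

end

end MultipleTesting

/-
Replacing the p-value of a true null below `lam` by `0` leaves `m̂₀` unchanged, and it leaves the
number of rejections unchanged if that null is rejected. Integrating out one uniform p-value
therefore gives `𝔼 FDP = 𝔼 C`, where `C = V(lam) α / (lam m̂₀)` and `V(lam)` counts the true nulls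
with p-value at most `lam`; integrating out a second one gives
`Var FDP = Var C + (𝔼 (C / R^{(1,lam)}) - 𝔼 (C α / (lam m̂₀)))`,
whose bracket is nonnegative. Its last term is `𝔼 (C² / V(lam))`, which vanishes in the limit since
`V(lam) / m → lam κ₀` by the law of large numbers. So the FDP concentrates iff `C` does and
`C / R^{(1,lam)} → 0`. Because `C · m̂₀ / m = (α / lam) V(lam) / m` has a positive limit and
`m̂₀ / m` is bounded, `C` concentrates iff `m̂₀ / m` does, and `C` is bounded away from `0`, so that
`C / R^{(1,lam)} → 0` iff `R^{(1,lam)} → ∞`.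
-/

namespace MultipleTesting

noncomputable section

open Function
open scoped Finset

variable {m : ℕ}

section Deterministic

/-- The indices in `I` of the entries of `x` that are at most `t`. The empirical distribution
function, the number of false rejections and the entry zeroed by `replaceOne` are all read off such
sets. -/
def entriesLE (I : Finset (Fin m)) (x : Fin m → ℝ) (t : ℝ) : Finset (Fin m) :=
  I.filter fun i => x i ≤ t

variable {I I₀ : Finset (Fin m)} {x : Fin m → ℝ} {i : Fin m} {t u : ℝ}

@[simp]
lemma mem_entriesLE : i ∈ entriesLE I x t ↔ i ∈ I ∧ x i ≤ t := Finset.mem_filter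

lemma entriesLE_subset (I : Finset (Fin m)) (x : Fin m → ℝ) (t : ℝ) : entriesLE I x t ⊆ I :=
  Finset.filter_subset _ _

lemma card_entriesLE_mono (I : Finset (Fin m)) (x : Fin m → ℝ) :
    Monotone fun t => #(entriesLE I x t) :=
  fun _ _ hst => Finset.card_le_card <| Finset.monotone_filter_right _ fun _ _ hi => hi.trans hst

lemma card_entriesLE_le (x : Fin m → ℝ) (t : ℝ) : #(entriesLE I x t) ≤ m := by
  simpa using Finset.card_le_univ (entriesLE I x t)

lemma entriesLE_subset_univ : entriesLE I x t ⊆ entriesLE Finset.univ x t :=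
  Finset.filter_subset_filter _ (Finset.subset_univ I)

lemma entriesLE_update (hi : x i ≤ t) (hu : u ≤ t) :
    entriesLE I (update x i u) t = entriesLE I x t := by
  ext j
  obtain rfl | hj := eq_or_ne j i
  · simp [hi, hu]
  · simp [hj]

lemma card_entriesLE_le_update (hu : u ≤ x i) (t : ℝ) :
    #(entriesLE I x t) ≤ #(entriesLE I (update x i u) t) := by
  refine Finset.card_le_card fun j => ?_
  obtain rfl | hj := eq_or_ne j i
  · simpa using fun hj hjt => ⟨hj, hu.trans hjt⟩
  · simp [hj]

lemma card_entriesLE_comp_perm (σ : Equiv.Perm (Fin m)) (x : Fin m → ℝ) (t : ℝ) :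
    #(entriesLE Finset.univ (x ∘ σ) t) = #(entriesLE Finset.univ x t) :=
  Finset.card_equiv σ (by simp)

lemma entriesLE_comp_swap {k : Fin m} (hi : i ∈ entriesLE I x t) (hk : k ∈ entriesLE I x t) :
    entriesLE I (x ∘ Equiv.swap i k) t = entriesLE I x t := by
  rw [mem_entriesLE] at hi hk
  ext j
  obtain rfl | hji := eq_or_ne j i
  · simp [hi, hk]
  obtain rfl | hjk := eq_or_ne j k
  · simp [hi, hk]
  · simp [Equiv.swap_apply_of_ne_of_ne hji hjk]

lemma entriesLE_comp_swap_eq_iff {k : Fin m} {A : Finset (Fin m)} (hi : i ∈ A) (hk : k ∈ A) :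
    entriesLE I (x ∘ Equiv.swap i k) t = A ↔ entriesLE I x t = A := by
  refine ⟨?_, ?_⟩
  · rintro rfl
    simpa [comp_assoc, ← Equiv.coe_trans] using entriesLE_comp_swap hi hk
  · rintro rfl
    exact entriesLE_comp_swap hi hk

lemma update_comp_swap (x : Fin m → ℝ) (i k : Fin m) (u : ℝ) :
    update (x ∘ Equiv.swap i k) i u = update x k u ∘ Equiv.swap i k := by
  simp [update_comp_equiv]

lemma countLE_eq_card (x : Fin m → ℝ) (t : ℝ) : countLE x t = #(entriesLE Finset.univ x t) := by
  obtain rfl | hm := Nat.eq_zero_or_pos m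
  · simp [countLE, entriesLE]
  · exact mul_div_cancel₀ _ (by positivity)

lemma orderStat_le_iff {k : ℕ} (hk : 1 ≤ k) (hkm : k ≤ m) (c : ℝ) :
    orderStat x k ≤ c ↔ k ≤ #(entriesLE Finset.univ x c) := by
  have key := Tuple.lt_card_le_iff_apply_le_of_monotone (f := x ∘ Tuple.sort x) (a := c)
    (j := (⟨k - 1, by omega⟩ : Fin m)) (Tuple.monotone_sort x)
  rw [← card_entriesLE_comp_perm (Tuple.sort x), orderStat, dif_pos ⟨hk, hkm⟩]
  refine key.symm.trans ?_
  simp only [entriesLE]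
  omega

variable {lam : ℝ}

lemma ecdfTail_update (hi : x i ≤ lam) (hu : u ≤ lam) :
    ecdfTail lam (update x i u) = ecdfTail lam x := by
  funext t
  exact congrArg (fun s => (#s : ℝ) / m) (entriesLE_update (hi.trans t.2) (hu.trans t.2))

lemma ecdfTail_comp_perm (σ : Equiv.Perm (Fin m)) (lam : ℝ) (x : Fin m → ℝ) :
    ecdfTail lam (x ∘ σ) = ecdfTail lam x := by
  funext t
  exact congrArg (fun k : ℕ => (k : ℝ) / m) (card_entriesLE_comp_perm σ x t)

variable {α : ℝ} {g : (Set.Ici lam → ℝ) → ℝ}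

lemma rejections_comp_perm (σ : Equiv.Perm (Fin m)) (α : ℝ) (g : (Set.Ici lam → ℝ) → ℝ)
    (x : Fin m → ℝ) : rejections α lam g (x ∘ σ) = rejections α lam g x := by
  have orderStat_comp : orderStat (x ∘ σ) = orderStat x := by
    funext k
    by_cases hk : 1 ≤ k ∧ k ≤ m
    · refine eq_of_forall_ge_iff fun c => ?_
      rw [orderStat_le_iff hk.1 hk.2, orderStat_le_iff hk.1 hk.2, card_entriesLE_comp_perm]
    · simp only [orderStat, dif_neg hk]
  unfold rejections stepUpRejections adaptiveCrit
  rw [orderStat_comp, ecdfTail_comp_perm]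

lemma adaptiveCrit_update (hi : x i ≤ lam) (hu : u ≤ lam) :
    adaptiveCrit α lam g (update x i u) = adaptiveCrit α lam g x := by
  rw [adaptiveCrit, ecdfTail_update hi hu, adaptiveCrit]

/-- The critical value `α̂_{R_m:m}` below which the adaptive test rejects. -/
def threshold (α lam : ℝ) (g : (Set.Ici lam → ℝ) → ℝ) (x : Fin m → ℝ) : ℝ :=
  adaptiveCrit α lam g x (rejections α lam g x)

lemma threshold_le : threshold α lam g x ≤ lam := min_le_right _ _

lemma le_rejections {k : ℕ} (hkm : k ≤ m)
    (hk : k ≤ #(entriesLE Finset.univ x (adaptiveCrit α lam g x k))) :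
    k ≤ rejections α lam g x := by
  obtain rfl | hk₀ := Nat.eq_zero_or_pos k
  · exact Nat.zero_le _
  · exact Nat.le_findGreatest hkm ((orderStat_le_iff hk₀ hkm _).2 hk)

lemma rejections_le : rejections α lam g x ≤ m := Nat.findGreatest_le _

lemma rejections_le_card_threshold :
    rejections α lam g x ≤ #(entriesLE Finset.univ x (threshold α lam g x)) := by
  obtain h₀ | h₀ := Nat.eq_zero_or_pos (rejections α lam g x)
  · exact h₀.trans_le (Nat.zero_le _)
  · rw [← orderStat_le_iff h₀ rejections_le]
    exact Nat.findGreatest_of_ne_zero (m := rejections α lam g x) rfl h₀.ne'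

lemma rejections_le_card : rejections α lam g x ≤ #(entriesLE Finset.univ x lam) :=
  rejections_le_card_threshold.trans (card_entriesLE_mono _ x threshold_le)

/-- The vectors of p-values allowed by assumption (A2): the entries are nonnegative, the estimator
is positive, and `R_m(lam) ≤ (lam / α) m̂₀`. -/
structure Admissible (α lam : ℝ) (g : (Set.Ici lam → ℝ) → ℝ) (x : Fin m → ℝ) : Prop where
  nonneg : ∀ i, 0 ≤ x i
  est_pos : 0 < g (ecdfTail lam x)
  card_mul_le : #(entriesLE Finset.univ x lam) * α ≤ lam * g (ecdfTail lam x)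

/-- The slope `α / (lam m̂₀)` of the critical values, relative to `lam`: given the p-values above
`lam`, a true null with p-value at most `lam` contributes `rate` to the conditional expectation of
the false discovery proportion. -/
def rate (α lam : ℝ) (g : (Set.Ici lam → ℝ) → ℝ) (x : Fin m → ℝ) : ℝ :=
  α / (lam * g (ecdfTail lam x))

/-- `V_m(lam) α / (lam m̂₀)`, where `V_m(lam)` counts the true nulls with p-value at most `lam`: the
conditional expectation of the false discovery proportion given the p-values above `lam`. -/
def condFDP (α lam : ℝ) (g : (Set.Ici lam → ℝ) → ℝ) (I₀ : Finset (Fin m)) (x : Fin m → ℝ) : ℝ :=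
  #(entriesLE I₀ x lam) * rate α lam g x

lemma rate_update (hi : x i ≤ lam) (hu : u ≤ lam) :
    rate α lam g (update x i u) = rate α lam g x := by
  rw [rate, ecdfTail_update hi hu, rate]

lemma rate_comp_perm (σ : Equiv.Perm (Fin m)) : rate α lam g (x ∘ σ) = rate α lam g x := by
  rw [rate, ecdfTail_comp_perm, rate]

lemma condFDP_update (hi : x i ≤ lam) (hu : u ≤ lam) :
    condFDP α lam g I₀ (update x i u) = condFDP α lam g I₀ x := by
  rw [condFDP, rate_update hi hu, entriesLE_update hi hu, condFDP]

lemma condFDP_erase (hi : i ∈ I₀) (hxi : x i ≤ lam) :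
    condFDP α lam g (I₀.erase i) x = condFDP α lam g I₀ x - rate α lam g x := by
  have hcard : #(entriesLE (I₀.erase i) x lam) + 1 = #(entriesLE I₀ x lam) := by
    rw [entriesLE, Finset.filter_erase]
    exact Finset.card_erase_add_one (mem_entriesLE.2 ⟨hi, hxi⟩)
  rw [condFDP, condFDP, ← hcard]
  push_cast
  ring

lemma condFDP_mul_rate :
    condFDP α lam g I₀ x * rate α lam g x = condFDP α lam g I₀ x ^ 2 / #(entriesLE I₀ x lam) := by
  obtain hempty | hx := (entriesLE I₀ x lam).eq_empty_or_nonempty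
  · simp [condFDP, hempty]
  · have : (#(entriesLE I₀ x lam) : ℝ) ≠ 0 := by exact_mod_cast hx.card_ne_zero
    rw [condFDP]
    field_simp

lemma falseRejections_eq_card :
    falseRejections α lam g I₀ x = #(entriesLE I₀ x (threshold α lam g x)) := rfl

lemma FDP_eq_sum (α lam : ℝ) (g : (Set.Ici lam → ℝ) → ℝ) (I₀ : Finset (Fin m)) (x : Fin m → ℝ) :
    FDP α lam g I₀ x =
      ∑ i ∈ I₀, if x i ≤ threshold α lam g x then 1 / (rejections α lam g x : ℝ) else 0 := by
  rw [FDP, falseRejections_eq_card, entriesLE, ← Finset.sum_filter, Finset.sum_const,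
    nsmul_eq_mul, mul_one_div]

lemma FDP_erase (hi : i ∈ I₀) (hxi : x i ≤ threshold α lam g x) :
    FDP α lam g (I₀.erase i) x = FDP α lam g I₀ x - 1 / rejections α lam g x := by
  rw [FDP_eq_sum, FDP_eq_sum, ← Finset.add_sum_erase I₀ _ hi, if_pos hxi, add_sub_cancel_left]

lemma FDP_nonneg : 0 ≤ FDP α lam g I₀ x := div_nonneg (Nat.cast_nonneg _) (Nat.cast_nonneg _)

lemma replaceOne_eq_update (hx : (entriesLE I₀ x lam).Nonempty) :
    replaceOne lam I₀ x = update x ((entriesLE I₀ x lam).min' hx) 0 := dif_pos hx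

namespace Admissible

variable (h : Admissible α lam g x)
include h

lemma update (hi : x i ≤ lam) (hu₀ : 0 ≤ u) (hu : u ≤ lam) :
    Admissible α lam g (update x i u) where
  nonneg j := by
    obtain rfl | hj := eq_or_ne j i
    · simpa using hu₀
    · simpa [hj] using h.nonneg j
  est_pos := by simpa only [ecdfTail_update hi hu] using h.est_pos
  card_mul_le := by simpa only [ecdfTail_update hi hu, entriesLE_update hi hu] using h.card_mul_le

lemma rate_nonneg (hα : 0 ≤ α) (hlam : 0 ≤ lam) : 0 ≤ rate α lam g x :=
  div_nonneg hα (mul_nonneg hlam h.est_pos.le)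

lemma rate_mul_card_le_one (hlam : 0 < lam) :
    rate α lam g x * #(entriesLE Finset.univ x lam) ≤ 1 := by
  rw [rate, div_mul_eq_mul_div, div_le_one (mul_pos hlam h.est_pos), mul_comm]
  exact h.card_mul_le

lemma rate_le_one (hα : 0 ≤ α) (hlam : 0 < lam) (hi : x i ≤ lam) : rate α lam g x ≤ 1 := by
  have hcard : (1 : ℝ) ≤ #(entriesLE Finset.univ x lam) :=
    mod_cast Finset.card_pos.2 ⟨i, by simpa using hi⟩
  exact (le_mul_of_one_le_right (h.rate_nonneg hα hlam.le) hcard).trans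
    (h.rate_mul_card_le_one hlam)

lemma condFDP_nonneg (hα : 0 ≤ α) (hlam : 0 ≤ lam) : 0 ≤ condFDP α lam g I₀ x :=
  mul_nonneg (Nat.cast_nonneg _) (h.rate_nonneg hα hlam)

lemma condFDP_le_one (hα : 0 ≤ α) (hlam : 0 < lam) : condFDP α lam g I₀ x ≤ 1 := by
  rw [condFDP, mul_comm]
  refine le_trans ?_ (h.rate_mul_card_le_one hlam)
  have := h.rate_nonneg hα hlam.le
  gcongr
  exact entriesLE_subset_univ

lemma threshold_eq (hα : 0 ≤ α) (hlam : 0 < lam) :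
    threshold α lam g x = lam * rate α lam g x * rejections α lam g x := by
  have hrate : lam * rate α lam g x * rejections α lam g x =
      rejections α lam g x / g (ecdfTail lam x) * α := by
    rw [rate]
    field_simp
  have hrej : rate α lam g x * rejections α lam g x ≤ 1 := by
    refine le_trans ?_ (h.rate_mul_card_le_one hlam)
    have := h.rate_nonneg hα hlam.le
    gcongr
    exact rejections_le_card
  rw [hrate]
  refine min_eq_left (hrate ▸ ?_)
  rw [mul_assoc]
  exact mul_le_of_le_one_right hlam.le hrej

lemma threshold_nonneg (hα : 0 ≤ α) (hlam : 0 < lam) : 0 ≤ threshold α lam g x := by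
  rw [h.threshold_eq hα hlam]
  have := h.rate_nonneg hα hlam.le
  positivity

lemma adaptiveCrit_mono (hα : 0 ≤ α) : Monotone (adaptiveCrit α lam g x) := by
  intro i j hij
  have := h.est_pos
  unfold adaptiveCrit critValue
  gcongr

lemma card_threshold (hα : 0 ≤ α) :
    #(entriesLE Finset.univ x (threshold α lam g x)) = rejections α lam g x := by
  refine le_antisymm ?_ rejections_le_card_threshold
  refine le_rejections (card_entriesLE_le _ _) (card_entriesLE_mono _ x ?_)
  exact h.adaptiveCrit_mono hα rejections_le_card_threshold

lemma FDP_le_one (hα : 0 ≤ α) : FDP α lam g I₀ x ≤ 1 := by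
  refine div_le_one_of_le₀ ?_ (Nat.cast_nonneg _)
  rw [← h.card_threshold hα, falseRejections_eq_card]
  exact_mod_cast Finset.card_le_card entriesLE_subset_univ

lemma rejections_le_update (hlam : 0 ≤ lam) (hi : x i ≤ lam) :
    rejections α lam g x ≤ rejections α lam g (Function.update x i 0) := by
  refine le_rejections rejections_le ?_
  rw [adaptiveCrit_update hi hlam]
  exact rejections_le_card_threshold.trans (card_entriesLE_le_update (h.nonneg i) _)

lemma rejections_update_of_le (hlam : 0 ≤ lam)
    (hi : x i ≤ threshold α lam g (Function.update x i 0)) :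
    rejections α lam g (Function.update x i 0) = rejections α lam g x := by
  have hil : x i ≤ lam := hi.trans threshold_le
  refine le_antisymm (le_rejections rejections_le ?_) (h.rejections_le_update hlam hil)
  rw [← adaptiveCrit_update (α := α) (g := g) hil hlam]
  exact rejections_le_card_threshold.trans_eq <|
    congrArg Finset.card (entriesLE_update hi ((h.nonneg i).trans hi))

lemma threshold_update_of_le (hlam : 0 ≤ lam)
    (hi : x i ≤ threshold α lam g (Function.update x i 0)) :
    threshold α lam g (Function.update x i 0) = threshold α lam g x := by
  rw [threshold, h.rejections_update_of_le hlam hi,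
    adaptiveCrit_update (hi.trans threshold_le) hlam, threshold]

lemma le_threshold_update_iff (hα : 0 ≤ α) (hlam : 0 ≤ lam) :
    x i ≤ threshold α lam g (Function.update x i 0) ↔ x i ≤ threshold α lam g x := by
  refine ⟨fun hi => (h.threshold_update_of_le hlam hi).subst hi, fun hi => hi.trans ?_⟩
  have hil := hi.trans threshold_le
  rw [threshold, threshold, adaptiveCrit_update hil hlam]
  exact h.adaptiveCrit_mono hα (h.rejections_le_update hlam hil)

lemma rejections_update (hα : 0 ≤ α) (hlam : 0 ≤ lam) (hi : x i ≤ threshold α lam g x) :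
    rejections α lam g (Function.update x i 0) = rejections α lam g x :=
  h.rejections_update_of_le hlam ((h.le_threshold_update_iff hα hlam).2 hi)

lemma FDP_update (hα : 0 ≤ α) (hlam : 0 ≤ lam) (hi : x i ≤ threshold α lam g x) :
    FDP α lam g I₀ (Function.update x i 0) = FDP α lam g I₀ x := by
  rw [FDP, FDP, h.rejections_update hα hlam hi, falseRejections_eq_card, falseRejections_eq_card,
    h.threshold_update_of_le hlam ((h.le_threshold_update_iff hα hlam).2 hi),
    entriesLE_update hi ((h.nonneg i).trans hi)]

lemma one_le_rejections_of_eq_zero (hα : 0 ≤ α) (hlam : 0 ≤ lam) (hi : x i = 0) :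
    1 ≤ rejections α lam g x := by
  refine le_rejections i.pos (Finset.card_pos.2 ⟨i, ?_⟩)
  have := h.est_pos
  rw [mem_entriesLE, hi, adaptiveCrit, critValue]
  exact ⟨Finset.mem_univ i, le_min (by positivity) hlam⟩

lemma rate_mul_rejections_update_le_one (hα : 0 ≤ α) (hlam : 0 < lam) (hi : x i ≤ lam) :
    rate α lam g x * rejections α lam g (Function.update x i 0) ≤ 1 := by
  refine le_trans ?_ (h.rate_mul_card_le_one hlam)
  rw [← entriesLE_update hi hlam.le]
  have := h.rate_nonneg hα hlam.le
  gcongr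
  exact rejections_le_card

lemma one_le_rejectionsOne (hα : 0 ≤ α) (hlam : 0 ≤ lam) (hx : (entriesLE I₀ x lam).Nonempty) :
    1 ≤ rejectionsOne α lam g I₀ x := by
  have hmin := mem_entriesLE.1 (Finset.min'_mem _ hx)
  rw [rejectionsOne, replaceOne_eq_update hx]
  exact (h.update hmin.2 le_rfl hlam).one_le_rejections_of_eq_zero hα hlam
    (Function.update_self ..)

lemma rate_mul_rejectionsOne_le_one (hα : 0 ≤ α) (hlam : 0 < lam)
    (hx : (entriesLE I₀ x lam).Nonempty) : rate α lam g x * rejectionsOne α lam g I₀ x ≤ 1 := by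
  have hmin := mem_entriesLE.1 (Finset.min'_mem _ hx)
  rw [rejectionsOne, replaceOne_eq_update hx]
  exact h.rate_mul_rejections_update_le_one hα hlam hmin.2

lemma condFDP_mul_rate_le (hα : 0 ≤ α) (hlam : 0 < lam) :
    condFDP α lam g I₀ x * rate α lam g x ≤
      condFDP α lam g I₀ x / rejectionsOne α lam g I₀ x := by
  obtain hempty | hx := (entriesLE I₀ x lam).eq_empty_or_nonempty
  · simp [condFDP, hempty]
  · have hR : (0 : ℝ) < rejectionsOne α lam g I₀ x := by
      exact_mod_cast h.one_le_rejectionsOne hα hlam.le hx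
    rw [le_div_iff₀ hR, mul_assoc]
    exact mul_le_of_le_one_right (h.condFDP_nonneg hα hlam.le)
      (h.rate_mul_rejectionsOne_le_one hα hlam hx)

lemma condFDP_mul_est (hlam : lam ≠ 0) :
    condFDP α lam g I₀ x * g (ecdfTail lam x) = α / lam * #(entriesLE I₀ x lam) := by
  have := h.est_pos.ne'
  rw [condFDP, rate]
  field_simp

end Admissible

end Deterministic

section Measurability

variable {I I₀ : Finset (Fin m)} {α lam : ℝ} {g : (Set.Ici lam → ℝ) → ℝ} {c : (Fin m → ℝ) → ℝ}

lemma measurableSet_entriesLE_eq (hc : Measurable c) (A : Finset (Fin m)) :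
    MeasurableSet {x | entriesLE I x (c x) = A} := by
  have hle (i : Fin m) : Measurable fun x : Fin m → ℝ => x i ≤ c x :=
    measurableSet_setOfPred.1 (measurableSet_le (measurable_pi_apply i) hc)
  simp_rw [Finset.ext_iff, mem_entriesLE]
  exact (Measurable.forall fun i => (measurable_const.and (hle i)).iff measurable_const).setOf

lemma measurable_comp_entriesLE {β : Type*} [MeasurableSpace β]
    {f : Finset (Fin m) → (Fin m → ℝ) → β} (hf : ∀ A, Measurable (f A)) (hc : Measurable c) :
    Measurable fun x => f (entriesLE I x (c x)) x := by
  let _ : MeasurableSpace (Finset (Fin m)) := ⊤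
  have hA : Measurable fun x => entriesLE I x (c x) :=
    measurable_to_countable' (measurableSet_entriesLE_eq hc)
  exact (measurable_from_prod_countable_right (f := uncurry f) hf).comp (hA.prodMk measurable_id)

lemma integral_eq_sum_entriesLE {μ : Measure (Fin m → ℝ)} {f : (Fin m → ℝ) → ℝ} {t : ℝ}
    (hf : Integrable f μ) : ∫ x, f x ∂μ = ∑ A, ∫ x in {x | entriesLE I x t = A}, f x ∂μ := by
  rw [← integral_iUnion_fintype (measurableSet_entriesLE_eq measurable_const)
    (fun A B hAB => Set.disjoint_left.2 fun x hA hB => hAB (hA.symm.trans hB))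
    fun A => hf.integrableOn]
  simp [Set.iUnion_ofPred]

@[fun_prop]
lemma measurable_card_entriesLE (hc : Measurable c) :
    Measurable fun x => (#(entriesLE I x (c x)) : ℝ) :=
  measurable_comp_entriesLE (f := fun A _ => (#A : ℝ)) (fun _ => measurable_const) hc

@[fun_prop]
lemma measurable_ecdfTail : Measurable (ecdfTail lam : (Fin m → ℝ) → Set.Ici lam → ℝ) :=
  measurable_pi_lambda _ fun _ => (measurable_card_entriesLE measurable_const).div_const _

@[fun_prop]
lemma measurable_adaptiveCrit (hg : Measurable g) (k : ℕ) :
    Measurable fun x : Fin m → ℝ => adaptiveCrit α lam g x k := by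
  unfold adaptiveCrit critValue
  fun_prop

lemma measurable_rejections_nat (hg : Measurable g) :
    Measurable fun x : Fin m → ℝ => rejections α lam g x := by
  refine measurable_findGreatest fun k hkm => ?_
  obtain rfl | hk := Nat.eq_zero_or_pos k
  · exact measurableSet_le measurable_const (measurable_adaptiveCrit hg 0)
  · simp_rw [orderStat_le_iff hk hkm]
    exact measurableSet_le measurable_const
      (measurable_comp_entriesLE (f := fun A _ => #A) (fun _ => measurable_const)
        (measurable_adaptiveCrit hg k))

@[fun_prop]
lemma measurable_rejections (hg : Measurable g) :
    Measurable fun x : Fin m → ℝ => (rejections α lam g x : ℝ) :=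
  measurable_from_top.comp (measurable_rejections_nat hg)

@[fun_prop]
lemma measurable_threshold (hg : Measurable g) :
    Measurable fun x : Fin m → ℝ => threshold α lam g x := by
  unfold threshold adaptiveCrit critValue
  fun_prop

@[fun_prop]
lemma measurable_rate (hg : Measurable g) : Measurable fun x : Fin m → ℝ => rate α lam g x := by
  unfold rate
  fun_prop

@[fun_prop]
lemma measurable_condFDP (hg : Measurable g) :
    Measurable fun x : Fin m → ℝ => condFDP α lam g I₀ x := by
  unfold condFDP
  fun_prop

@[fun_prop]
lemma measurable_FDP (hg : Measurable g) : Measurable fun x : Fin m → ℝ => FDP α lam g I₀ x := by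
  simp_rw [FDP, falseRejections_eq_card]
  fun_prop

lemma measurable_replaceOne : Measurable (replaceOne lam I₀) := by
  refine measurable_comp_entriesLE (I := I₀) (c := fun _ => lam)
    (f := fun A x => if h : A.Nonempty then update x (A.min' h) 0 else x) (fun A => ?_)
    measurable_const
  split_ifs <;> fun_prop

@[fun_prop]
lemma measurable_rejectionsOne (hg : Measurable g) :
    Measurable fun x : Fin m → ℝ => (rejectionsOne α lam g I₀ x : ℝ) :=
  (measurable_rejections hg).comp measurable_replaceOne

lemma measurableSet_admissible (hg : Measurable g) :
    MeasurableSet {x : Fin m → ℝ | Admissible α lam g x} := by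
  have : {x : Fin m → ℝ | Admissible α lam g x} =
      (⋂ i, {x | 0 ≤ x i}) ∩ ({x | 0 < g (ecdfTail lam x)} ∩
        {x | #(entriesLE Finset.univ x lam) * α ≤ lam * g (ecdfTail lam x)}) := by
    ext x
    simp only [Set.mem_inter_iff, Set.mem_iInter, Set.mem_ofPred_eq]
    exact ⟨fun h => ⟨h.nonneg, h.est_pos, h.card_mul_le⟩, fun h => ⟨h.1, h.2.1, h.2.2⟩⟩
  rw [this]
  refine .inter (.iInter fun i => ?_) (.inter ?_ ?_)
  · exact measurableSet_le (by fun_prop) (by fun_prop)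
  · exact measurableSet_lt (by fun_prop) (by fun_prop)
  · exact measurableSet_le (by fun_prop) (by fun_prop)

end Measurability

section Law

variable {μ : Measure (Fin m → ℝ)} {i k : Fin m}

/-- Under the law `μ` of a random vector, the `i`-th coordinate is uniform on `[0, 1]` and
independent of the other ones; this is encoded by the invariance of `μ` under replacing the `i`-th
coordinate by an independent uniform variable. -/
def IsUniformCoord (μ : Measure (Fin m → ℝ)) (i : Fin m) : Prop :=
  MeasurePreserving (fun z : (Fin m → ℝ) × ℝ => update z.1 i z.2)
    (μ.prod (volume.restrict (Set.Icc 0 1))) μ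

/-- The law of the vector whose `i`-th coordinate is replaced by `0`. -/
def zeroLaw (μ : Measure (Fin m → ℝ)) (i : Fin m) : Measure (Fin m → ℝ) :=
  μ.map fun x => update x i 0

instance [SFinite μ] : SFinite (zeroLaw μ i) := inferInstanceAs (SFinite (μ.map _))

instance [IsProbabilityMeasure μ] : IsProbabilityMeasure (zeroLaw μ i) :=
  Measure.isProbabilityMeasure_map (by fun_prop)

lemma ae_zeroLaw_iff {p : (Fin m → ℝ) → Prop} (hp : MeasurableSet {x | p x}) :
    (∀ᵐ x ∂zeroLaw μ i, p x) ↔ ∀ᵐ x ∂μ, p (update x i 0) :=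
  ae_map_iff (by fun_prop) hp

lemma ae_zeroLaw_apply_eq_zero : ∀ᵐ x ∂zeroLaw μ i, x i = 0 :=
  (ae_zeroLaw_iff (measurableSet_eq_fun (by fun_prop) (by fun_prop))).2 (by simp)

lemma integral_zeroLaw {F : (Fin m → ℝ) → ℝ} (hF : Measurable F) :
    ∫ x, F x ∂zeroLaw μ i = ∫ x, F (update x i 0) ∂μ :=
  integral_map (by fun_prop) hF.aestronglyMeasurable

lemma integral_Icc_ite_le {t : ℝ} (ht : t ∈ Set.Icc (0 : ℝ) 1) (c : ℝ) :
    ∫ u in Set.Icc (0 : ℝ) 1, (if u ≤ t then c else 0) = t * c := by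
  have : (fun u : ℝ => if u ≤ t then c else 0) = (Set.Iic t).indicator fun _ => c := by
    ext u; simp [Set.indicator]
  rw [this, setIntegral_indicator measurableSet_Iic, ← Set.Ici_inter_Iic, Set.inter_assoc,
    Set.Iic_inter_Iic, inf_eq_right.2 ht.2, Set.Ici_inter_Iic]
  simp [ht.1]

namespace IsUniformCoord

variable (h : IsUniformCoord μ i)
include h

lemma ae_update {p : (Fin m → ℝ) → Prop} (hp : ∀ᵐ x ∂μ, p x) :
    ∀ᵐ x ∂μ, ∀ᵐ u ∂volume.restrict (Set.Icc (0 : ℝ) 1), p (update x i u) :=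
  Measure.ae_ae_of_ae_prod (h.quasiMeasurePreserving.ae hp)

lemma integral_update [SFinite μ] {f : (Fin m → ℝ) → ℝ} (hf : Measurable f)
    (hf_int : Integrable f μ) :
    ∫ x, (∫ u in Set.Icc (0 : ℝ) 1, f (update x i u)) ∂μ = ∫ x, f x ∂μ := by
  rw [integral_integral (f := fun x u => f (update x i u)) (h.integrable_comp_of_integrable hf_int),
    ← integral_map h.aemeasurable hf.aestronglyMeasurable, h.map_eq]

lemma setIntegral_le [IsFiniteMeasure μ] {T F : (Fin m → ℝ) → ℝ} {C : ℝ} (hT : Measurable T)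
    (hF : Measurable F) (hT_mem : ∀ᵐ x ∂zeroLaw μ i, T x ∈ Set.Icc 0 1)
    (hT_iff : ∀ᵐ x ∂μ, x i ≤ T (update x i 0) ↔ x i ≤ T x)
    (hF_eq : ∀ᵐ x ∂μ, x i ≤ T x → F (update x i 0) = F x)
    (hF_le : ∀ᵐ x ∂μ, x i ≤ T x → |F x| ≤ C) :
    ∫ x in {x | x i ≤ T x}, F x ∂μ = ∫ x, T x * F x ∂zeroLaw μ i := by
  have hA : MeasurableSet {x | x i ≤ T x} := measurableSet_le (by fun_prop) hT
  rw [ae_zeroLaw_iff (measurableSet_Icc.preimage hT)] at hT_mem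
  have integrable : Integrable ({x | x i ≤ T x}.indicator F) μ := by
    rw [integrable_indicator_iff hA]
    refine Integrable.of_bound (C := C) hF.aestronglyMeasurable ?_
    rwa [ae_restrict_iff' hA]
  rw [← integral_indicator hA, ← h.integral_update (hF.indicator hA) integrable,
    integral_zeroLaw (by fun_prop)]
  refine integral_congr_ae ?_
  filter_upwards [hT_mem, h.ae_update (hT_iff.and hF_eq)] with x hTx hx
  rw [← integral_Icc_ite_le hTx]
  refine integral_congr_ae ?_
  filter_upwards [hx] with u hu
  simp only [update_idem, update_self] at hu
  by_cases huT : u ≤ T (update x i 0)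
  · simpa [Set.indicator, huT, hu.1.1 huT] using (hu.2 (hu.1.1 huT)).symm
  · simp [Set.indicator, huT, hu.1.not.1 huT]

lemma zeroLaw_of_ne [SFinite μ] (hki : k ≠ i) :
    IsUniformCoord (zeroLaw μ k) i := by
  have hzero : MeasurePreserving (fun x => update x k 0) μ (zeroLaw μ k) :=
    Measurable.measurePreserving (by fun_prop) μ
  refine ⟨by exact measurable_update', ?_⟩
  rw [← (hzero.prod (.id _)).map_eq, Measure.map_map measurable_update' (by fun_prop)]
  convert (hzero.comp h).map_eq using 2
  funext z
  exact (update_comm hki.symm _ _ _).symm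

lemma measurePreserving_comp_swap [SFinite μ] (hk : IsUniformCoord μ k) :
    MeasurePreserving (fun x => x ∘ Equiv.swap i k) μ μ := by
  obtain rfl | hik := eq_or_ne i k
  · simpa [Function.comp_def] using! MeasurePreserving.id μ
  have hi_k := hk.comp (h.prod (.id (volume.restrict (Set.Icc (0 : ℝ) 1))))
  have hk_i := h.comp (hk.prod (.id (volume.restrict (Set.Icc (0 : ℝ) 1))))
  have hswap : Measurable fun x : Fin m → ℝ => x ∘ Equiv.swap i k :=
    measurable_pi_lambda _ fun j => measurable_pi_apply _
  refine ⟨hswap, ?_⟩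
  conv_lhs => rw [← hi_k.map_eq]
  rw [Measure.map_map hswap hi_k.measurable]
  convert hk_i.map_eq using 2
  funext z j
  obtain rfl | hj := eq_or_ne j i
  · simp
  obtain rfl | hj' := eq_or_ne j k
  · simp [hik, hik.symm]
  · simp [hj, hj', Equiv.swap_apply_of_ne_of_ne]

end IsUniformCoord

end Law

section BasicIndependence

variable {Ω : Type*} [MeasurableSpace Ω] {P : Measure Ω} [IsProbabilityMeasure P]

lemma IsUniformCoord.of_indepFun {Y : Ω → Fin m → ℝ} {i : Fin m} (hY : Measurable Y)
    (hY_map : P.map (fun ω => Y ω i) = volume.restrict (Set.Icc 0 1))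
    (hY_indep : IndepFun (fun ω => update (Y ω) i 0) (fun ω => Y ω i) P) :
    IsUniformCoord (P.map Y) i := by
  have := Measure.isProbabilityMeasure_map (μ := P) hY.aemeasurable
  have hzero : Measurable fun x : Fin m → ℝ => update x i 0 := by fun_prop
  have hYzero : Measurable fun ω => update (Y ω) i 0 := hzero.comp hY
  rw [indepFun_iff_map_prod_eq_prod_map_map (by fun_prop) (by fun_prop), hY_map] at hY_indep
  refine ⟨measurable_update', ?_⟩
  calc ((P.map Y).prod (volume.restrict (Set.Icc 0 1))).map (fun z => update z.1 i z.2)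
      = (((P.map Y).prod (volume.restrict (Set.Icc 0 1))).map
          (Prod.map (fun x => update x i 0) id)).map (fun z => update z.1 i z.2) := by
        rw [Measure.map_map measurable_update' (by fun_prop)]
        congr 1
        funext z
        simp
    _ = (P.map fun ω => (update (Y ω) i 0, Y ω i)).map (fun z => update z.1 i z.2) := by
        rw [← Measure.map_prod_map _ _ hzero measurable_id, Measure.map_id,
          Measure.map_map hzero hY, hY_indep]
        rfl
    _ = P.map Y := by
        rw [Measure.map_map measurable_update' (by fun_prop)]
        congr 1
        funext ω
        simp

lemma indepFun_prodMk_of_indepFun {β γ δ : Type*} [MeasurableSpace β] [MeasurableSpace γ]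
    [MeasurableSpace δ] {A : Ω → β} {B : Ω → γ} {C : Ω → δ} (hA : Measurable A) (hB : Measurable B)
    (hC : Measurable C) (hAB : IndepFun A B P) (hABC : IndepFun (fun ω => (A ω, B ω)) C P) :
    IndepFun A (fun ω => (B ω, C ω)) P := by
  have := Measure.isProbabilityMeasure_map (μ := P) hA.aemeasurable
  have := Measure.isProbabilityMeasure_map (μ := P) hB.aemeasurable
  have := Measure.isProbabilityMeasure_map (μ := P) hC.aemeasurable
  have hBC : IndepFun B C P := hABC.comp measurable_snd measurable_id
  rw [indepFun_iff_map_prod_eq_prod_map_map (by fun_prop) (by fun_prop)] at hAB hABC hBC ⊢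
  rw [hBC, ← Measure.prodAssoc_prod, ← hAB, ← hABC,
    Measure.map_map (by fun_prop) (by fun_prop)]
  rfl

lemma map_eq_restrict_Icc {X : Ω → ℝ} (hX : Measurable X) (hX_mem : ∀ ω, X ω ∈ Set.Icc 0 1)
    (hX_le : ∀ t ∈ Set.Icc (0 : ℝ) 1, P {ω | X ω ≤ t} = ENNReal.ofReal t) :
    P.map X = volume.restrict (Set.Icc 0 1) := by
  have := Measure.isProbabilityMeasure_map (μ := P) hX.aemeasurable
  refine Measure.ext_of_Iic _ _ fun t => ?_
  rw [Measure.map_apply hX measurableSet_Iic, Measure.restrict_apply measurableSet_Iic,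
    Set.inter_comm, ← Set.Ici_inter_Iic, Set.inter_assoc, Set.Iic_inter_Iic, Set.Ici_inter_Iic,
    Real.volume_Icc, sub_zero]
  obtain ht | ht := lt_or_ge t 0
  · have : X ⁻¹' Set.Iic t = ∅ := Set.eq_empty_of_forall_notMem fun ω hω =>
      (hω.trans_lt ht).not_ge (hX_mem ω).1
    rw [this, measure_empty, ENNReal.ofReal_of_nonpos (inf_le_right.trans ht.le)]
  obtain ht' | ht' := le_total t 1
  · rw [inf_eq_right.2 ht', ← hX_le t ⟨ht, ht'⟩]
    rfl
  · rw [inf_eq_left.2 ht', ← hX_le 1 (by simp)]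
    exact measure_congr (.of_forall fun ω => propext
      ⟨fun _ => (hX_mem ω).2, fun h => h.trans ht'⟩)

namespace BasicIndependence

variable {I₀ : Finset (Fin m)} {p : Fin m → Ω → ℝ} {i : Fin m}

omit [IsProbabilityMeasure P] in
lemma measurable_vec (h : BasicIndependence P I₀ p) : Measurable fun ω i => p i ω :=
  measurable_pi_lambda _ h.measurable

lemma indepFun_others (h : BasicIndependence P I₀ p) (hi : i ∈ I₀) :
    IndepFun (p i) (fun ω => (fun j : {j : I₀ // j ∈ Finset.univ.erase ⟨i, hi⟩} => p j ω,
      fun j : {j // j ∉ I₀} => p j ω)) P := by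
  have hp (i) := h.measurable i
  refine indepFun_prodMk_of_indepFun (by fun_prop) (by fun_prop) (by fun_prop) ?_ ?_
  · refine (h.indep_null.indepFun_finset {⟨i, hi⟩} (Finset.univ.erase ⟨i, hi⟩) (by simp)
      fun j => hp j).comp (φ := fun z => z ⟨⟨i, hi⟩, by simp⟩) (ψ := id) ?_ measurable_id
    fun_prop
  · refine h.indep_null_alt.comp
      (φ := fun z => (z ⟨i, hi⟩, fun j : {j : I₀ // j ∈ Finset.univ.erase ⟨i, hi⟩} => z j))
      (ψ := id) ?_ measurable_id
    fun_prop

lemma indepFun_update (h : BasicIndependence P I₀ p) (hi : i ∈ I₀) :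
    IndepFun (p i) (fun ω => update (fun j => p j ω) i 0) P := by
  let assemble (z : ({j : I₀ // j ∈ Finset.univ.erase ⟨i, hi⟩} → ℝ) × ({j // j ∉ I₀} → ℝ))
      (j : Fin m) : ℝ :=
    if hj : j ∈ I₀ then if hji : j = i then 0 else z.1 ⟨⟨j, hj⟩, by simp [hji]⟩
    else z.2 ⟨j, hj⟩
  have hassemble : Measurable assemble := by
    refine measurable_pi_lambda _ fun j => ?_
    unfold assemble
    split_ifs <;> fun_prop
  rw [← Function.id_comp (p i)]
  convert (h.indepFun_others hi).comp measurable_id hassemble using 1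
  ext ω j
  by_cases hj : j ∈ I₀
  · by_cases hji : j = i
    · simp [assemble, hi, hji]
    · simp [assemble, hj, hji]
  · have hji : j ≠ i := fun e => hj (e ▸ hi)
    simp [assemble, hj, hji]

lemma isUniformCoord (h : BasicIndependence P I₀ p) (hi : i ∈ I₀) :
    IsUniformCoord (P.map fun ω i => p i ω) i :=
  .of_indepFun h.measurable_vec
    (map_eq_restrict_Icc (h.measurable i) (h.mem_Icc i) (h.uniform_null i hi))
    (h.indepFun_update hi).symm

end BasicIndependence

end BasicIndependence

section Moments

/-- The law `μ` of the p-values makes the true nulls `I₀` uniform and independent of the remaining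
p-values, and almost surely satisfies assumption (A2). -/
structure AdaptiveModel (α lam : ℝ) (g : (Set.Ici lam → ℝ) → ℝ) (I₀ : Finset (Fin m))
    (μ : Measure (Fin m → ℝ)) : Prop where
  alpha_pos : 0 < α
  lam_pos : 0 < lam
  lam_le_one : lam ≤ 1
  measurable_est : Measurable g
  uniform : ∀ i ∈ I₀, IsUniformCoord μ i
  admissible : ∀ᵐ x ∂μ, Admissible α lam g x

lemma abs_div_natCast_le (a : ℝ) (n : ℕ) : |a / n| ≤ |a| := by
  obtain rfl | hn := Nat.eq_zero_or_pos n
  · simp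
  · rw [abs_div, Nat.abs_cast]
    exact div_le_self (abs_nonneg a) (mod_cast hn)

namespace AdaptiveModel

variable {I₀ : Finset (Fin m)} {i k : Fin m} {α lam : ℝ} {g : (Set.Ici lam → ℝ) → ℝ}
  {μ : Measure (Fin m → ℝ)} {φ : (Fin m → ℝ) → ℝ} (h : AdaptiveModel α lam g I₀ μ)
include h

lemma zero [SFinite μ] (hi : i ∈ I₀) : AdaptiveModel α lam g (I₀.erase i) (zeroLaw μ i) where
  alpha_pos := h.alpha_pos
  lam_pos := h.lam_pos
  lam_le_one := h.lam_le_one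
  measurable_est := h.measurable_est
  uniform j hj := (h.uniform j (Finset.mem_of_mem_erase hj)).zeroLaw_of_ne
    (Finset.ne_of_mem_erase hj).symm
  admissible := by
    have : (ae (volume.restrict (Set.Icc 0 lam))).NeBot :=
      ae_restrict_neBot.2 (by simp [h.lam_pos])
    rw [ae_zeroLaw_iff (measurableSet_admissible h.measurable_est)]
    filter_upwards [(h.uniform i hi).ae_update h.admissible] with x hx
    obtain ⟨u, hxu, hu⟩ := ((ae_restrict_of_ae_restrict_of_subset
      (Set.Icc_subset_Icc_right h.lam_le_one) hx).and (ae_restrict_mem measurableSet_Icc)).exists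
    simpa using hxu.update (i := i) (by simpa using hu.2) le_rfl h.lam_pos.le

lemma ae_FDP_le_one : ∀ᵐ x ∂μ, |FDP α lam g I₀ x| ≤ 1 := by
  filter_upwards [h.admissible] with x hx
  exact (abs_of_nonneg FDP_nonneg).trans_le (hx.FDP_le_one h.alpha_pos.le)

lemma ae_condFDP_mem_Icc : ∀ᵐ x ∂μ, 0 ≤ condFDP α lam g I₀ x ∧ condFDP α lam g I₀ x ≤ 1 := by
  filter_upwards [h.admissible] with x hx
  exact ⟨hx.condFDP_nonneg h.alpha_pos.le h.lam_pos.le,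
    hx.condFDP_le_one h.alpha_pos.le h.lam_pos⟩

lemma ae_condFDP_le_one : ∀ᵐ x ∂μ, |condFDP α lam g I₀ x| ≤ 1 :=
  h.ae_condFDP_mem_Icc.mono fun _ hx => (abs_of_nonneg hx.1).trans_le hx.2

lemma ae_rejectionsOne_pos :
    ∀ᵐ x ∂μ, 0 < condFDP α lam g I₀ x → (0 : ℝ) < rejectionsOne α lam g I₀ x := by
  filter_upwards [h.admissible] with x hx hpos
  refine Nat.cast_pos.2 (hx.one_le_rejectionsOne h.alpha_pos.le h.lam_pos.le ?_)
  rw [Finset.nonempty_iff_ne_empty]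
  rintro hempty
  simp [condFDP, hempty] at hpos

lemma ae_rate_le_one : ∀ᵐ x ∂μ, ∀ i, x i ≤ lam → |rate α lam g x| ≤ 1 := by
  filter_upwards [h.admissible] with x hx i hi
  exact (abs_of_nonneg (hx.rate_nonneg h.alpha_pos.le h.lam_pos.le)).trans_le
    (hx.rate_le_one h.alpha_pos.le h.lam_pos hi)

lemma ae_condFDP_sub_rate_le_one :
    ∀ᵐ x ∂μ, ∀ i, x i ≤ lam → |condFDP α lam g I₀ x - rate α lam g x| ≤ 1 := by
  have hα := h.alpha_pos.le
  have hlam := h.lam_pos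
  filter_upwards [h.admissible] with x hx i hi
  exact abs_sub_le_of_nonneg_of_le (hx.condFDP_nonneg hα hlam.le) (hx.condFDP_le_one hα hlam)
    (hx.rate_nonneg hα hlam.le) (hx.rate_le_one hα hlam hi)

variable [IsProbabilityMeasure μ]

lemma setIntegral_le_threshold (hi : i ∈ I₀) (hφ : Measurable φ)
    (hφ_eq : ∀ᵐ x ∂μ, x i ≤ threshold α lam g x → φ (update x i 0) = φ x)
    (hφ_le : ∀ᵐ x ∂μ, |φ x| ≤ 1) :
    ∫ x in {x | x i ≤ threshold α lam g x}, φ x / rejections α lam g x ∂μ =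
      lam * ∫ x, rate α lam g x * φ x ∂zeroLaw μ i := by
  have hg := h.measurable_est
  have hα := h.alpha_pos.le
  have hlam := h.lam_pos
  rw [(h.uniform i hi).setIntegral_le (T := threshold α lam g)
    (F := fun x => φ x / rejections α lam g x) (C := 1)
    (measurable_threshold hg) (hφ.div (measurable_rejections hg)), ← integral_const_mul]
  · refine integral_congr_ae ?_
    filter_upwards [(h.zero hi).admissible, ae_zeroLaw_apply_eq_zero] with x hx hxi
    have := hx.one_le_rejections_of_eq_zero hα hlam.le hxi
    rw [hx.threshold_eq hα hlam]
    field_simp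
  · filter_upwards [(h.zero hi).admissible] with x hx
    exact ⟨hx.threshold_nonneg hα hlam, threshold_le.trans h.lam_le_one⟩
  · filter_upwards [h.admissible] with x hx using hx.le_threshold_update_iff hα hlam.le
  · filter_upwards [h.admissible, hφ_eq] with x hx hφx hxi
    rw [hφx hxi, hx.rejections_update hα hlam.le hxi]
  · filter_upwards [hφ_le] with x hφx _
    exact (abs_div_natCast_le _ _).trans hφx

lemma setIntegral_le_lam (hi : i ∈ I₀) (hφ : Measurable φ)
    (hφ_eq : ∀ x, x i ≤ lam → φ (update x i 0) = φ x) (hφ_le : ∀ᵐ x ∂μ, x i ≤ lam → |φ x| ≤ 1) :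
    ∫ x in {x | x i ≤ lam}, φ x ∂μ = lam * ∫ x, φ x ∂zeroLaw μ i := by
  rw [(h.uniform i hi).setIntegral_le (T := fun _ => lam) measurable_const hφ
    (.of_forall fun _ => ⟨h.lam_pos.le, h.lam_le_one⟩) (by simp) (.of_forall hφ_eq) hφ_le,
    integral_const_mul]

lemma integral_FDP_mul (hφ : Measurable φ)
    (hφ_eq : ∀ᵐ x ∂μ, ∀ i ∈ I₀, x i ≤ threshold α lam g x → φ (update x i 0) = φ x)
    (hφ_le : ∀ᵐ x ∂μ, |φ x| ≤ 1) :
    ∫ x, FDP α lam g I₀ x * φ x ∂μ =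
      ∑ i ∈ I₀, lam * ∫ x, rate α lam g x * φ x ∂zeroLaw μ i := by
  have hg := h.measurable_est
  have hmeas (i : Fin m) : MeasurableSet {x : Fin m → ℝ | x i ≤ threshold α lam g x} :=
    measurableSet_le (by fun_prop) (by fun_prop)
  have hsum (x : Fin m → ℝ) : FDP α lam g I₀ x * φ x = ∑ i ∈ I₀,
      {x | x i ≤ threshold α lam g x}.indicator (fun x => φ x / rejections α lam g x) x := by
    simp only [FDP_eq_sum, Finset.sum_mul, Set.indicator, Set.mem_ofPred_eq, ite_mul, zero_mul,
      one_div_mul_eq_div]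
  simp_rw [hsum]
  rw [integral_finsetSum _ fun i _ => ?_]
  · refine Finset.sum_congr rfl fun i hi => ?_
    rw [integral_indicator (hmeas i), h.setIntegral_le_threshold hi hφ _ hφ_le]
    filter_upwards [hφ_eq] with x hx using hx i hi
  · refine Integrable.indicator (.of_bound (C := 1) ?_ ?_) (hmeas i)
    · exact (hφ.div (measurable_rejections hg)).aestronglyMeasurable
    · filter_upwards [hφ_le] with x hx using (abs_div_natCast_le _ _).trans hx

lemma integral_condFDP_mul (hφ : Measurable φ)
    (hφ_le : ∀ᵐ x ∂μ, ∀ i ∈ I₀, x i ≤ lam → |φ x| ≤ 1) :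
    ∫ x, condFDP α lam g I₀ x * φ x ∂μ =
      ∑ i ∈ I₀, ∫ x in {x | x i ≤ lam}, rate α lam g x * φ x ∂μ := by
  have hg := h.measurable_est
  have hmeas (i : Fin m) : MeasurableSet {x : Fin m → ℝ | x i ≤ lam} :=
    measurableSet_le (by fun_prop) measurable_const
  have hsum (x : Fin m → ℝ) : condFDP α lam g I₀ x * φ x =
      ∑ i ∈ I₀, {x | x i ≤ lam}.indicator (fun x => rate α lam g x * φ x) x := by
    simp only [condFDP, entriesLE, Set.indicator, Set.mem_ofPred_eq, ← Finset.sum_filter,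
      Finset.sum_const, nsmul_eq_mul, mul_assoc]
  simp_rw [hsum]
  rw [integral_finsetSum _ fun i hi => ?_]
  · simp_rw [integral_indicator (hmeas _)]
  · rw [integrable_indicator_iff (hmeas i)]
    refine Integrable.of_bound (C := 1) (by fun_prop) ?_
    rw [ae_restrict_iff' (hmeas i)]
    filter_upwards [h.ae_rate_le_one, hφ_le] with x hx hφx hxi
    rw [norm_mul]
    exact mul_le_one₀ (hx i hxi) (abs_nonneg _) (hφx i hi hxi)

lemma integral_FDP_mul_eq_condFDP (hφ : Measurable φ)
    (hφ_eq : ∀ i ∈ I₀, ∀ x, x i ≤ lam → φ (update x i 0) = φ x) (hφ_le : ∀ᵐ x ∂μ, |φ x| ≤ 1) :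
    ∫ x, FDP α lam g I₀ x * φ x ∂μ = ∫ x, condFDP α lam g I₀ x * φ x ∂μ := by
  have hg := h.measurable_est
  rw [h.integral_FDP_mul hφ (.of_forall fun x i hi hx => hφ_eq i hi x (hx.trans threshold_le))
    hφ_le, h.integral_condFDP_mul hφ (hφ_le.mono fun x hx _ _ _ => hx)]
  refine Finset.sum_congr rfl fun i hi => (h.setIntegral_le_lam hi (by fun_prop) ?_ ?_).symm
  · intro x hx
    rw [rate_update hx h.lam_pos.le, hφ_eq i hi x hx]
  · filter_upwards [h.ae_rate_le_one, hφ_le] with x hx hφx hxi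
    rw [abs_mul]
    exact mul_le_one₀ (hx i hxi) (abs_nonneg _) hφx

lemma integral_FDP : ∫ x, FDP α lam g I₀ x ∂μ = ∫ x, condFDP α lam g I₀ x ∂μ := by
  simpa using h.integral_FDP_mul_eq_condFDP (φ := fun _ => 1) measurable_const (by simp) (by simp)

lemma integral_rate_mul_FDP_zeroLaw (hi : i ∈ I₀) :
    ∫ x, rate α lam g x * FDP α lam g I₀ x ∂zeroLaw μ i =
      ∫ x, rate α lam g x / rejections α lam g x ∂zeroLaw μ i +
        ∫ x, rate α lam g x * (condFDP α lam g I₀ x - rate α lam g x) ∂zeroLaw μ i := by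
  have hg := h.measurable_est
  have hα := h.alpha_pos.le
  have hlam := h.lam_pos
  have hzero := h.zero hi
  have hrate : ∀ᵐ x ∂zeroLaw μ i, |rate α lam g x| ≤ 1 := by
    filter_upwards [hzero.ae_rate_le_one, ae_zeroLaw_apply_eq_zero] with x hx hxi
    exact hx i (hxi.trans_le hlam.le)
  have hcond : ∫ x, rate α lam g x * (condFDP α lam g I₀ x - rate α lam g x) ∂zeroLaw μ i =
      ∫ x, FDP α lam g (I₀.erase i) x * rate α lam g x ∂zeroLaw μ i := by
    rw [hzero.integral_FDP_mul_eq_condFDP (by fun_prop) (fun j _ x hx => rate_update hx hlam.le)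
      hrate]
    refine integral_congr_ae ?_
    filter_upwards [ae_zeroLaw_apply_eq_zero] with x hxi
    rw [condFDP_erase hi (hxi.trans_le hlam.le), mul_comm]
  rw [hcond, ← integral_add]
  · refine integral_congr_ae ?_
    filter_upwards [hzero.admissible, ae_zeroLaw_apply_eq_zero] with x hx hxi
    rw [FDP_erase hi (hxi.trans_le (hx.threshold_nonneg hα hlam))]
    ring
  · refine .of_bound (C := 1) ?_ ?_
    · exact ((measurable_rate hg).div (measurable_rejections hg)).aestronglyMeasurable
    · filter_upwards [hrate] with x hx using (abs_div_natCast_le _ _).trans hx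
  · refine .of_bound (C := 1) (by fun_prop) ?_
    filter_upwards [hzero.ae_FDP_le_one, hrate] with x hx hrx
    rw [norm_mul]
    exact mul_le_one₀ hx (abs_nonneg _) hrx

lemma lam_mul_integral_rate_mul_FDP_zeroLaw (hi : i ∈ I₀) :
    lam * ∫ x, rate α lam g x * FDP α lam g I₀ x ∂zeroLaw μ i =
      ∫ x in {x | x i ≤ lam}, rate α lam g x / rejections α lam g (update x i 0) ∂μ +
        ∫ x in {x | x i ≤ lam}, rate α lam g x * (condFDP α lam g I₀ x - rate α lam g x) ∂μ := by
  have hg := h.measurable_est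
  have hlam := h.lam_pos.le
  have hrej : Measurable fun x : Fin m → ℝ => (rejections α lam g (update x i 0) : ℝ) :=
    (measurable_rejections hg).comp (by fun_prop)
  rw [h.integral_rate_mul_FDP_zeroLaw hi, mul_add,
    h.setIntegral_le_lam (φ := fun x => rate α lam g x / rejections α lam g (update x i 0)) hi
      ((measurable_rate hg).div hrej) ?_ ?_,
    h.setIntegral_le_lam hi (by fun_prop) ?_ ?_]
  · congr 2
    refine integral_congr_ae ?_
    filter_upwards [ae_zeroLaw_apply_eq_zero] with x hxi
    rw [← hxi, update_eq_self]
  · intro x hx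
    rw [condFDP_update hx hlam, rate_update hx hlam]
  · filter_upwards [h.ae_rate_le_one, h.ae_condFDP_sub_rate_le_one (I₀ := I₀)] with x hx hcx hxi
    rw [abs_mul]
    exact mul_le_one₀ (hx i hxi) (abs_nonneg _) (hcx i hxi)
  · intro x hx
    rw [rate_update hx hlam, update_idem]
  · filter_upwards [h.ae_rate_le_one] with x hx hxi
    exact (abs_div_natCast_le _ _).trans (hx i hxi)

lemma setIntegral_entriesLE_eq_rate_div {A : Finset (Fin m)} (hA : A ⊆ I₀) (hi : i ∈ A)
    (hk : k ∈ A) :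
    ∫ x in {x | entriesLE I₀ x lam = A}, rate α lam g x / rejections α lam g (update x i 0) ∂μ =
      ∫ x in {x | entriesLE I₀ x lam = A},
        rate α lam g x / rejections α lam g (update x k 0) ∂μ := by
  have hswap := (h.uniform i (hA hi)).measurePreserving_comp_swap (h.uniform k (hA hk))
  have hfiber : (fun x => x ∘ Equiv.swap i k) ⁻¹' {x | entriesLE I₀ x lam = A} =
      {x | entriesLE I₀ x lam = A} := by
    ext x
    exact entriesLE_comp_swap_eq_iff hi hk
  have hemb : MeasurableEmbedding fun x : Fin m → ℝ => x ∘ Equiv.swap i k :=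
    (MeasurableEquiv.arrowCongr' (Equiv.swap i k) (.refl ℝ)).measurableEmbedding
  rw [← hswap.setIntegral_preimage_emb hemb, hfiber]
  simp only [rate_comp_perm, update_comp_swap, rejections_comp_perm]

lemma setIntegral_rate_div_rejections (hi : i ∈ I₀) :
    ∫ x in {x | x i ≤ lam}, rate α lam g x / rejections α lam g (update x i 0) ∂μ =
      ∫ x in {x | x i ≤ lam}, rate α lam g x / rejectionsOne α lam g I₀ x ∂μ := by
  have hg := h.measurable_est
  have hmeas : MeasurableSet {x : Fin m → ℝ | x i ≤ lam} :=
    measurableSet_le (by fun_prop) measurable_const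
  have integrable (n : (Fin m → ℝ) → ℕ) (hn : Measurable fun x => (n x : ℝ)) :
      IntegrableOn (fun x => rate α lam g x / n x) {x | x i ≤ lam} μ := by
    refine Integrable.of_bound (C := 1) ((measurable_rate hg).div hn).aestronglyMeasurable ?_
    rw [ae_restrict_iff' hmeas]
    filter_upwards [h.ae_rate_le_one] with x hx hxi
    exact (abs_div_natCast_le _ _).trans (hx i hxi)
  rw [integral_eq_sum_entriesLE (I := I₀) (t := lam)
      (integrable _ ((measurable_rejections hg).comp (by fun_prop))),
    integral_eq_sum_entriesLE (I := I₀) (t := lam) (integrable _ (measurable_rejectionsOne hg))]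
  refine Finset.sum_congr rfl fun A _ => ?_
  simp only [Measure.restrict_restrict (measurableSet_entriesLE_eq measurable_const A)]
  by_cases hA : A ⊆ I₀ ∧ i ∈ A
  · have hfiber : {x | entriesLE I₀ x lam = A} ∩ {x | x i ≤ lam} =
        {x | entriesLE I₀ x lam = A} := by
      refine Set.inter_eq_left.2 ?_
      rintro x rfl
      exact (mem_entriesLE.1 hA.2).2
    rw [hfiber, h.setIntegral_entriesLE_eq_rate_div hA.1 hA.2 (A.min'_mem ⟨i, hA.2⟩)]
    refine setIntegral_congr_fun (measurableSet_entriesLE_eq measurable_const A) ?_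
    rintro x rfl
    simp only [rejectionsOne, replaceOne_eq_update ⟨i, hA.2⟩]
  · have hfiber : {x | entriesLE I₀ x lam = A} ∩ {x | x i ≤ lam} = ∅ := by
      refine Set.eq_empty_of_forall_notMem ?_
      rintro x ⟨rfl, hxi⟩
      exact hA ⟨entriesLE_subset I₀ x lam, mem_entriesLE.2 ⟨hi, hxi⟩⟩
    simp only [hfiber, Measure.restrict_empty, integral_zero_measure]

lemma integral_condFDP_div_rejectionsOne :
    ∫ x, condFDP α lam g I₀ x / rejectionsOne α lam g I₀ x ∂μ =
      ∑ i ∈ I₀, ∫ x in {x | x i ≤ lam},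
        rate α lam g x / rejections α lam g (update x i 0) ∂μ := by
  have hg := h.measurable_est
  simp_rw [div_eq_mul_inv]
  rw [h.integral_condFDP_mul (by fun_prop)]
  · simp_rw [← div_eq_mul_inv]
    exact Finset.sum_congr rfl fun i hi => (h.setIntegral_rate_div_rejections hi).symm
  · refine .of_forall fun x _ _ _ => ?_
    simpa using abs_div_natCast_le 1 (rejectionsOne α lam g I₀ x)

lemma integrable_condFDP_mul (hφ : Measurable φ)
    (hφ_le : ∀ᵐ x ∂μ, ∀ i ∈ I₀, x i ≤ lam → |φ x| ≤ 1) :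
    Integrable (fun x => condFDP α lam g I₀ x * φ x) μ := by
  have hg := h.measurable_est
  refine .of_bound (C := 1) (by fun_prop) ?_
  filter_upwards [h.ae_condFDP_le_one, hφ_le] with x hx hφx
  obtain hempty | ⟨i, hi⟩ := (entriesLE I₀ x lam).eq_empty_or_nonempty
  · simp [condFDP, hempty]
  · rw [norm_mul]
    rw [mem_entriesLE] at hi
    exact mul_le_one₀ hx (abs_nonneg _) (hφx i hi.1 hi.2)

lemma integral_condFDP_mul_rate_le :
    ∫ x, condFDP α lam g I₀ x * rate α lam g x ∂μ ≤
      ∫ x, condFDP α lam g I₀ x / rejectionsOne α lam g I₀ x ∂μ := by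
  have hg := h.measurable_est
  refine integral_mono_ae
    (h.integrable_condFDP_mul (by fun_prop) (h.ae_rate_le_one.mono fun x hx i _ => hx i))
    (.of_bound ((measurable_condFDP hg).div (measurable_rejectionsOne hg)).aestronglyMeasurable 1
      (h.ae_condFDP_le_one.mono fun x hx => (abs_div_natCast_le _ _).trans hx)) ?_
  filter_upwards [h.admissible] with x hx using hx.condFDP_mul_rate_le h.alpha_pos.le h.lam_pos

lemma integral_FDP_sq :
    ∫ x, FDP α lam g I₀ x ^ 2 ∂μ = ∫ x, condFDP α lam g I₀ x ^ 2 ∂μ +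
      (∫ x, condFDP α lam g I₀ x / rejectionsOne α lam g I₀ x ∂μ -
        ∫ x, condFDP α lam g I₀ x * rate α lam g x ∂μ) := by
  have hg := h.measurable_est
  simp_rw [sq]
  rw [h.integral_FDP_mul (by fun_prop) ?_ h.ae_FDP_le_one]
  · rw [Finset.sum_congr rfl fun i hi => h.lam_mul_integral_rate_mul_FDP_zeroLaw hi,
      Finset.sum_add_distrib, ← h.integral_condFDP_div_rejectionsOne,
      ← h.integral_condFDP_mul (by fun_prop)
        (h.ae_condFDP_sub_rate_le_one.mono fun x hx i _ => hx i)]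
    simp_rw [mul_sub]
    rw [integral_sub
      (h.integrable_condFDP_mul (by fun_prop) (h.ae_condFDP_le_one.mono fun x hx _ _ _ => hx))
      (h.integrable_condFDP_mul (by fun_prop) (h.ae_rate_le_one.mono fun x hx i _ => hx i))]
    ring
  · filter_upwards [h.admissible] with x hx i _ hxi
    exact hx.FDP_update h.alpha_pos.le h.lam_pos.le hxi

theorem variance_FDP :
    Var[FDP α lam g I₀; μ] = Var[condFDP α lam g I₀; μ] +
      (∫ x, condFDP α lam g I₀ x / rejectionsOne α lam g I₀ x ∂μ -
        ∫ x, condFDP α lam g I₀ x * rate α lam g x ∂μ) := by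
  have hg := h.measurable_est
  rw [variance_eq_sub, variance_eq_sub]
  · simp only [Pi.pow_apply, h.integral_FDP_sq, h.integral_FDP]
    ring
  · exact MemLp.of_bound (by fun_prop) 1 h.ae_condFDP_le_one
  · exact MemLp.of_bound (by fun_prop) 1 h.ae_FDP_le_one

end AdaptiveModel

end Moments

section ConvergenceInProbability

variable {Ω : ℕ → Type*} [∀ m, MeasurableSpace (Ω m)] {P : ∀ m, Measure (Ω m)}
  {X Y Z : ∀ m, Ω m → ℝ} {C : ℝ}

lemma tendsto_measure_zero_of_imp_or {p q r : ∀ m, Ω m → Prop}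
    (hq : Tendsto (fun m => P m {ω | q m ω}) atTop (𝓝 0))
    (hr : Tendsto (fun m => P m {ω | r m ω}) atTop (𝓝 0))
    (hp : ∀ᶠ m in atTop, ∀ᵐ ω ∂P m, p m ω → q m ω ∨ r m ω) :
    Tendsto (fun m => P m {ω | p m ω}) atTop (𝓝 0) := by
  refine tendsto_of_tendsto_of_tendsto_of_le_of_le' tendsto_const_nhds
    (by simpa using hq.add hr) (.of_forall fun _ => zero_le) ?_
  filter_upwards [hp] with m hm
  exact (measure_mono_ae hm).trans (measure_union_le _ _)

lemma TendstoZeroInProb.of_imp_or (hY : TendstoZeroInProb P Y) (hZ : TendstoZeroInProb P Z)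
    (hX : ∀ ε > 0, ∃ δ > 0, ∀ᶠ m in atTop, ∀ᵐ ω ∂P m,
      ε ≤ |X m ω| → δ ≤ |Y m ω| ∨ δ ≤ |Z m ω|) : TendstoZeroInProb P X := by
  intro ε hε
  obtain ⟨δ, hδ, h⟩ := hX ε hε
  exact tendsto_measure_zero_of_imp_or (hY δ hδ) (hZ δ hδ) h

lemma TendstoZeroInProb.of_imp (hY : TendstoZeroInProb P Y)
    (hX : ∀ ε > 0, ∃ δ > 0, ∀ᶠ m in atTop, ∀ᵐ ω ∂P m, ε ≤ |X m ω| → δ ≤ |Y m ω|) :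
    TendstoZeroInProb P X :=
  .of_imp_or hY hY <| by simpa only [or_self] using hX

lemma TendstoZeroInProb.const_mul {c : ℝ} (hc : 0 < c) (hX : TendstoZeroInProb P X) :
    TendstoZeroInProb P fun m ω => c * X m ω := by
  refine hX.of_imp fun ε hε => ⟨ε / c, by positivity, .of_forall fun m => .of_forall fun ω hω => ?_⟩
  rwa [abs_mul, abs_of_pos hc, ← div_le_iff₀' hc] at hω

lemma TendstoZeroInProb.sub_const {a : ℕ → ℝ}
    (hX : TendstoZeroInProb P fun m ω => X m ω - a m) {c : ℝ} (ha : Tendsto a atTop (𝓝 c)) :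
    TendstoZeroInProb P fun m ω => X m ω - c := by
  refine hX.of_imp fun ε hε => ⟨ε / 2, half_pos hε, ?_⟩
  filter_upwards [Metric.tendsto_nhds.1 ha (ε / 2) (half_pos hε)] with m hm
  refine .of_forall fun ω hω => ?_
  rw [Real.dist_eq] at hm
  linarith [abs_sub_le (X m ω) (a m) c]

lemma tendstoZeroInProb_sq_iff :
    TendstoZeroInProb P (fun m ω => X m ω ^ 2) ↔ TendstoZeroInProb P X := by
  refine ⟨fun h => h.of_imp fun ε hε => ⟨ε ^ 2, by positivity, ?_⟩,
    fun h => h.of_imp fun ε hε => ⟨√ε, by positivity, ?_⟩⟩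
  all_goals refine .of_forall fun m => .of_forall fun ω hω => ?_
  · rw [abs_pow]
    gcongr
  · rw [abs_pow] at hω
    exact (Real.sqrt_le_left (abs_nonneg _)).2 hω

lemma tendstoZeroInProb_map_iff {E : ℕ → Type*} [∀ m, MeasurableSpace (E m)]
    {T : ∀ m, Ω m → E m} (hT : ∀ m, Measurable (T m)) {f : ∀ m, E m → ℝ}
    (hf : ∀ m, Measurable (f m)) :
    TendstoZeroInProb (fun m => (P m).map (T m)) f ↔
      TendstoZeroInProb P fun m ω => f m (T m ω) := by
  have h (ε : ℝ) (m) : (P m).map (T m) {x | ε ≤ |f m x|} = P m {ω | ε ≤ |f m (T m ω)|} :=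
    Measure.map_apply (hT m) (measurableSet_le measurable_const (hf m).abs)
  simp only [TendstoZeroInProb, h]

lemma tendstoZeroInProb_map_sub_integral_iff {E : ℕ → Type*} [∀ m, MeasurableSpace (E m)]
    {T : ∀ m, Ω m → E m} (hT : ∀ m, Measurable (T m)) {f : ∀ m, E m → ℝ}
    (hf : ∀ m, Measurable (f m)) :
    TendstoZeroInProb (fun m => (P m).map (T m))
        (fun m x => f m x - ∫ y, f m y ∂(P m).map (T m)) ↔
      TendstoZeroInProb P fun m ω => f m (T m ω) - ∫ ω', f m (T m ω') ∂P m := by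
  rw [tendstoZeroInProb_map_iff hT fun m => (hf m).sub_const _]
  simp only [integral_map (hT _).aemeasurable (hf _).aestronglyMeasurable]

lemma tendstoInftyInProb_map_iff {E : ℕ → Type*} [∀ m, MeasurableSpace (E m)]
    {T : ∀ m, Ω m → E m} (hT : ∀ m, Measurable (T m)) {f : ∀ m, E m → ℝ}
    (hf : ∀ m, Measurable (f m)) :
    TendstoInftyInProb (fun m => (P m).map (T m)) f ↔
      TendstoInftyInProb P fun m ω => f m (T m ω) := by
  have h (C : ℝ) (m) : (P m).map (T m) {x | f m x ≤ C} = P m {ω | f m (T m ω) ≤ C} :=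
    Measure.map_apply (hT m) (measurableSet_le (hf m) measurable_const)
  simp only [TendstoInftyInProb, h]

lemma TendstoZeroInProb.tendstoInftyInProb_of_div_natCast {c : ℝ} (hc : 0 < c)
    (hX : TendstoZeroInProb P fun m ω => X m ω / m - c) : TendstoInftyInProb P X := by
  intro C
  refine tendsto_measure_zero_of_imp_or (hX (c / 2) (half_pos hc)) (hX (c / 2) (half_pos hc)) ?_
  filter_upwards [(tendsto_const_div_atTop_nhds_zero_nat C).eventually_le_const (half_pos hc)]
    with m hm
  refine .of_forall fun ω hω => .inl ?_
  rw [abs_sub_comm]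
  have : X m ω / m ≤ C / m := by gcongr
  exact (by linarith : c / 2 ≤ c - X m ω / m).trans (le_abs_self _)

lemma TendstoInftyInProb.div_tendstoZeroInProb (hY : TendstoInftyInProb P Y)
    (hX : ∀ᶠ m in atTop, ∀ᵐ ω ∂P m, |X m ω| ≤ C) :
    TendstoZeroInProb P fun m ω => X m ω / Y m ω := by
  intro ε hε
  refine tendsto_measure_zero_of_imp_or (hY (C / ε)) (hY (C / ε)) ?_
  filter_upwards [hX] with m hm
  filter_upwards [hm] with ω hω hdiv
  refine .inl (not_lt.1 fun hlt => hdiv.not_gt ?_)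
  have hpos : 0 < Y m ω := (div_nonneg ((abs_nonneg _).trans hω) hε.le).trans_lt hlt
  rw [abs_div, abs_of_pos hpos, div_lt_iff₀ hpos]
  exact hω.trans_lt ((div_lt_iff₀' hε).1 hlt)

lemma TendstoZeroInProb.tendstoInftyInProb_of_div {η : ℝ} (hη : 0 < η)
    (h : TendstoZeroInProb P fun m ω => X m ω / Y m ω)
    (hXη : Tendsto (fun m => P m {ω | X m ω < η}) atTop (𝓝 0))
    (hXY : ∀ᶠ m in atTop, ∀ᵐ ω ∂P m, 0 < X m ω → 0 < Y m ω) : TendstoInftyInProb P Y := by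
  intro C
  refine tendsto_measure_zero_of_imp_or (h (η / max C 1) (by positivity)) hXη ?_
  filter_upwards [hXY] with m hm
  filter_upwards [hm] with ω hω hC
  refine (lt_or_ge (X m ω) η).symm.imp_left fun hle => ?_
  have hX : 0 < X m ω := hη.trans_le hle
  have hY := hω hX
  rw [abs_of_pos (div_pos hX hY)]
  gcongr
  exact hC.trans (le_max_left _ _)

lemma div_two_mul_le_of_abs_mul_sub_lt {a b c K : ℝ} (ha : 0 ≤ a) (hb : b ≤ K) (hK : 0 < K)
    (h : |a * b - c| < c / 2) : c / (2 * K) ≤ a := by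
  rw [div_le_iff₀ (by positivity)]
  nlinarith [(abs_lt.1 h).1]

lemma TendstoZeroInProb.tendsto_measure_lt_of_mul {c K : ℝ} (hc : 0 < c) (hK : 0 < K)
    (hXY : TendstoZeroInProb P fun m ω => X m ω * Y m ω - c)
    (hX : ∀ᶠ m in atTop, ∀ᵐ ω ∂P m, 0 ≤ X m ω) (hY : ∀ᶠ m in atTop, ∀ᵐ ω ∂P m, Y m ω ≤ K) :
    Tendsto (fun m => P m {ω | X m ω < c / (2 * K)}) atTop (𝓝 0) := by
  refine tendsto_measure_zero_of_imp_or (hXY _ (half_pos hc)) (hXY _ (half_pos hc)) ?_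
  filter_upwards [hX, hY] with m hX hY
  filter_upwards [hX, hY] with ω hX hY hlt
  exact .inl (not_lt.1 fun h => hlt.not_ge (div_two_mul_le_of_abs_mul_sub_lt hX hY hK h))

-- For `b = max a η`: `b (y - c / b) = (b - x) y + (x y - c)`, where `|b - x| ≤ |a - x|`.
lemma mul_abs_sub_div_max_le {a c x y η K : ℝ} (hη : 0 < η) (hx : η ≤ x) (hy : 0 ≤ y)
    (hyK : y ≤ K) : η * |y - c / max a η| ≤ K * |x - a| + |x * y - c| := by
  have hK : 0 ≤ K := hy.trans hyK
  set b := max a η with hb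
  have hηb : η ≤ b := le_max_right _ _
  have hb₀ : b ≠ 0 := (hη.trans_le hηb).ne'
  have hbx : |b - x| ≤ |x - a| := by
    rw [abs_sub_comm, hb]
    simpa only [max_eq_left hx] using abs_max_sub_max_le_abs x a η
  calc η * |y - c / b| ≤ |b| * |y - c / b| := by gcongr; exact hηb.trans (le_abs_self b)
    _ = |y * (b - x) + (x * y - c)| := by rw [← abs_mul]; congr 1; field_simp; ring
    _ ≤ |y| * |b - x| + |x * y - c| := (abs_add_le _ _).trans_eq (by rw [abs_mul])
    _ ≤ K * |x - a| + |x * y - c| := by rw [abs_of_nonneg hy]; gcongr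

lemma TendstoZeroInProb.sub_div_of_mul {c K : ℝ} {a : ℕ → ℝ} (hc : 0 < c) (hK : 0 < K)
    (hXY : TendstoZeroInProb P fun m ω => X m ω * Y m ω - c)
    (hXa : TendstoZeroInProb P fun m ω => X m ω - a m)
    (hX : ∀ᶠ m in atTop, ∀ᵐ ω ∂P m, 0 ≤ X m ω)
    (hY : ∀ᶠ m in atTop, ∀ᵐ ω ∂P m, 0 ≤ Y m ω ∧ Y m ω ≤ K) :
    TendstoZeroInProb P fun m ω => Y m ω - c / max (a m) (c / (2 * K)) := by
  set η := c / (2 * K)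
  have hη : 0 < η := by positivity
  refine hXa.of_imp_or hXY fun ε hε => ⟨min (c / 2) (η * ε / (K + 1)), by positivity, ?_⟩
  filter_upwards [hX, hY] with m hX hY
  filter_upwards [hX, hY] with ω hX ⟨hY₀, hYK⟩ hle
  by_contra! hlt
  have hXη : η ≤ X m ω :=
    div_two_mul_le_of_abs_mul_sub_lt hX hYK hK (hlt.2.trans_le (min_le_left _ _))
  have hX_lt : |X m ω - a m| < η * ε / (K + 1) := hlt.1.trans_le (min_le_right _ _)
  have hXY_lt : |X m ω * Y m ω - c| < η * ε / (K + 1) := hlt.2.trans_le (min_le_right _ _)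
  have : η * ε < η * ε := calc
    η * ε ≤ η * |Y m ω - c / max (a m) η| := by gcongr
    _ ≤ K * |X m ω - a m| + |X m ω * Y m ω - c| := mul_abs_sub_div_max_le hη hXη hY₀ hYK
    _ < K * (η * ε / (K + 1)) + η * ε / (K + 1) := by gcongr
    _ = η * ε := by field_simp
  exact this.false

variable [∀ m, IsProbabilityMeasure (P m)]

lemma tendstoZeroInProb_of_tendsto_integral (hX : ∀ᶠ m in atTop, Integrable (X m) (P m))
    (hX₀ : ∀ᶠ m in atTop, ∀ᵐ ω ∂P m, 0 ≤ X m ω)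
    (h : Tendsto (fun m => ∫ ω, X m ω ∂P m) atTop (𝓝 0)) : TendstoZeroInProb P X := by
  intro ε hε
  have markov : ∀ᶠ m in atTop, (P m).real {ω | ε ≤ |X m ω|} ≤ ε⁻¹ * ∫ ω, X m ω ∂P m := by
    filter_upwards [hX, hX₀] with m hX hX₀
    have habs : ∫ ω, X m ω ∂P m = ∫ ω, |X m ω| ∂P m :=
      integral_congr_ae (hX₀.mono fun ω hω => (abs_of_nonneg hω).symm)
    rw [habs, ← div_eq_inv_mul, le_div_iff₀' hε]
    exact mul_meas_ge_le_integral_of_nonneg (.of_forall fun _ => abs_nonneg _) hX.abs ε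
  have hreal : Tendsto (fun m => (P m).real {ω | ε ≤ |X m ω|}) atTop (𝓝 0) :=
    squeeze_zero' (.of_forall fun _ => measureReal_nonneg) markov (by simpa using h.const_mul ε⁻¹)
  simpa using ENNReal.tendsto_ofReal hreal

lemma integral_abs_le_add_mul_measureReal {Ω : Type*} [MeasurableSpace Ω] {P : Measure Ω}
    [IsProbabilityMeasure P] {X : Ω → ℝ} (hX : Measurable X) (hXC : ∀ᵐ ω ∂P, |X ω| ≤ C)
    {ε : ℝ} (hε : 0 ≤ ε) : ∫ ω, |X ω| ∂P ≤ ε + C * P.real {ω | ε ≤ |X ω|} := by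
  have hs : MeasurableSet {ω | ε ≤ |X ω|} := measurableSet_le measurable_const hX.abs
  have hi : Integrable ({ω | ε ≤ |X ω|}.indicator fun _ => C) P :=
    (integrable_const C).indicator hs
  calc ∫ ω, |X ω| ∂P ≤ ∫ ω, (ε + {ω | ε ≤ |X ω|}.indicator (fun _ => C) ω) ∂P := by
        refine integral_mono_of_nonneg (.of_forall fun _ => abs_nonneg _)
          ((integrable_const ε).add hi) ?_
        filter_upwards [hXC] with ω hω
        by_cases h : ε ≤ |X ω|
        · rw [Set.indicator_of_mem (by exact h)]
          linarith
        · rw [Set.indicator_of_notMem (by exact h)]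
          linarith
    _ = ε + C * P.real {ω | ε ≤ |X ω|} := by
        rw [integral_add (integrable_const ε) hi, integral_indicator hs]
        simp [mul_comm]

lemma TendstoZeroInProb.tendsto_integral (h : TendstoZeroInProb P X)
    (hX : ∀ᶠ m in atTop, Measurable (X m)) (hXC : ∀ᶠ m in atTop, ∀ᵐ ω ∂P m, |X m ω| ≤ C) :
    Tendsto (fun m => ∫ ω, X m ω ∂P m) atTop (𝓝 0) := by
  rw [Metric.tendsto_nhds]
  intro ε hε
  have hreal : Tendsto (fun m => C * (P m).real {ω | ε / 2 ≤ |X m ω|}) atTop (𝓝 0) := by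
    simpa [Measure.real] using
      ((ENNReal.tendsto_toReal ENNReal.zero_ne_top).comp (h _ (half_pos hε))).const_mul C
  filter_upwards [hX, hXC, hreal.eventually_lt_const (half_pos hε)] with m hX hXC hm
  rw [dist_zero_right, Real.norm_eq_abs]
  linarith [abs_integral_le_integral_abs (μ := P m) (f := X m),
    integral_abs_le_add_mul_measureReal hX hXC (half_pos hε).le]

lemma tendstoZeroInProb_iff_tendsto_integral (hX : ∀ᶠ m in atTop, Measurable (X m))
    (hX₀ : ∀ᶠ m in atTop, ∀ᵐ ω ∂P m, 0 ≤ X m ω) (hXC : ∀ᶠ m in atTop, ∀ᵐ ω ∂P m, |X m ω| ≤ C) :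
    TendstoZeroInProb P X ↔ Tendsto (fun m => ∫ ω, X m ω ∂P m) atTop (𝓝 0) := by
  refine ⟨fun h => h.tendsto_integral hX hXC, tendstoZeroInProb_of_tendsto_integral ?_ hX₀⟩
  filter_upwards [hX, hXC] with m hX hXC using .of_bound hX.aestronglyMeasurable C hXC

lemma TendstoZeroInProb.tendsto_integral_sub_sq {a : ℕ → ℝ} {D : ℝ}
    (h : TendstoZeroInProb P fun m ω => X m ω - a m)
    (hX : ∀ᶠ m in atTop, Measurable (X m)) (hXC : ∀ᶠ m in atTop, ∀ᵐ ω ∂P m, |X m ω| ≤ C)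
    (ha : ∀ᶠ m in atTop, |a m| ≤ D) :
    Tendsto (fun m => ∫ ω, (X m ω - a m) ^ 2 ∂P m) atTop (𝓝 0) := by
  refine (tendstoZeroInProb_sq_iff.2 h).tendsto_integral (C := (C + D) ^ 2) ?_ ?_
  · filter_upwards [hX] with m hX using by fun_prop
  · filter_upwards [hXC, ha] with m hXC ha
    filter_upwards [hXC] with ω hω
    rw [abs_pow]
    gcongr
    exact (abs_sub _ _).trans (add_le_add hω ha)

lemma tendstoZeroInProb_sub_integral_iff (hX : ∀ᶠ m in atTop, Measurable (X m))
    (hXC : ∀ᶠ m in atTop, ∀ᵐ ω ∂P m, |X m ω| ≤ C) :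
    TendstoZeroInProb P (fun m ω => X m ω - ∫ ω', X m ω' ∂P m) ↔
      Tendsto (fun m => Var[X m; P m]) atTop (𝓝 0) := by
  have hVar : ∀ᶠ m in atTop, Var[X m; P m] = ∫ ω, (X m ω - ∫ ω', X m ω' ∂P m) ^ 2 ∂P m :=
    hX.mono fun m hm => variance_eq_integral hm.aemeasurable
  have hE : ∀ᶠ m in atTop, |∫ ω', X m ω' ∂P m| ≤ C := by
    filter_upwards [hXC] with m hXC
    simpa using norm_integral_le_of_norm_le_const (f := X m) hXC
  rw [tendsto_congr' hVar]
  refine ⟨fun h => h.tendsto_integral_sub_sq hX hXC hE, fun h => tendstoZeroInProb_sq_iff.1 <|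
    tendstoZeroInProb_of_tendsto_integral ?_ (.of_forall fun m => .of_forall fun ω => sq_nonneg _)
    h⟩
  filter_upwards [hX, hXC] with m hX hXC
  exact ((MemLp.of_bound hX.aestronglyMeasurable C hXC).sub (memLp_const _)).integrable_sq

lemma TendstoZeroInProb.sub_integral {a : ℕ → ℝ} {D : ℝ}
    (h : TendstoZeroInProb P fun m ω => X m ω - a m) (hX : ∀ᶠ m in atTop, Measurable (X m))
    (hXC : ∀ᶠ m in atTop, ∀ᵐ ω ∂P m, |X m ω| ≤ C) (ha : ∀ᶠ m in atTop, |a m| ≤ D) :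
    TendstoZeroInProb P fun m ω => X m ω - ∫ ω', X m ω' ∂P m := by
  rw [tendstoZeroInProb_sub_integral_iff hX hXC]
  refine squeeze_zero' (.of_forall fun _ => variance_nonneg _ _) ?_
    (h.tendsto_integral_sub_sq hX hXC ha)
  filter_upwards [hX] with m hX
  rw [← variance_sub_const hX.aestronglyMeasurable (a m)]
  exact variance_le_expectation_sq (by fun_prop)

lemma TendstoZeroInProb.sub_integral_of_mul {c K : ℝ} (hc : 0 < c) (hK : 0 < K)
    (hXY : TendstoZeroInProb P fun m ω => X m ω * Y m ω - c)
    (hXE : TendstoZeroInProb P fun m ω => X m ω - ∫ ω', X m ω' ∂P m)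
    (hX : ∀ᶠ m in atTop, ∀ᵐ ω ∂P m, 0 ≤ X m ω) (hYm : ∀ᶠ m in atTop, Measurable (Y m))
    (hY : ∀ᶠ m in atTop, ∀ᵐ ω ∂P m, 0 ≤ Y m ω ∧ Y m ω ≤ K) :
    TendstoZeroInProb P fun m ω => Y m ω - ∫ ω', Y m ω' ∂P m := by
  refine (hXY.sub_div_of_mul hc hK hXE hX hY).sub_integral (C := K) (D := 2 * K) hYm ?_
    (.of_forall fun m => ?_)
  · filter_upwards [hY] with m hY
    filter_upwards [hY] with ω hω using (abs_of_nonneg hω.1).trans_le hω.2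
  · have hpos : 0 < max (∫ ω', X m ω' ∂P m) (c / (2 * K)) := lt_max_of_lt_right (by positivity)
    rw [abs_of_pos (div_pos hc hpos), div_le_iff₀ hpos]
    calc c = 2 * K * (c / (2 * K)) := by field_simp
      _ ≤ _ := by gcongr; exact le_max_right _ _

end ConvergenceInProbability

section LawOfLargeNumbers

lemma natCast_card_entriesLE (I : Finset (Fin m)) (x : Fin m → ℝ) (t : ℝ) :
    (#(entriesLE I x t) : ℝ) = ∑ i ∈ I, (Set.Iic t).indicator 1 (x i) := by
  simp [entriesLE, Set.indicator_apply]

namespace BasicIndependence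

variable {Ω : Type*} [MeasurableSpace Ω] {P : Measure Ω} [IsProbabilityMeasure P]
  {I₀ : Finset (Fin m)} {p : Fin m → Ω → ℝ} {t : ℝ} (h : BasicIndependence P I₀ p)
include h

lemma memLp_indicator (i : Fin m) (t : ℝ) :
    MemLp (fun ω => (Set.Iic t).indicator (1 : ℝ → ℝ) (p i ω)) 2 P := by
  have hp := h.measurable i
  have h1 : Measurable ((Set.Iic t).indicator (1 : ℝ → ℝ)) :=
    measurable_one.indicator measurableSet_Iic
  refine .of_bound (h1.comp hp).aestronglyMeasurable 1 (.of_forall fun ω => ?_)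
  simpa using norm_indicator_le_norm_self (s := Set.Iic t) (1 : ℝ → ℝ) (p i ω)

lemma integral_card_entriesLE (ht : t ∈ Set.Icc 0 1) :
    ∫ ω, (#(entriesLE I₀ (fun i => p i ω) t) : ℝ) ∂P = t * #I₀ := by
  simp_rw [natCast_card_entriesLE]
  rw [integral_finsetSum _ fun i _ => (h.memLp_indicator i t).integrable one_le_two,
    Finset.sum_congr rfl fun i hi => ?_, Finset.sum_const, nsmul_eq_mul, mul_comm]
  calc ∫ ω, (Set.Iic t).indicator 1 (p i ω) ∂P = P.real {ω | p i ω ≤ t} :=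
        integral_indicator_one (measurableSet_le (h.measurable i) measurable_const)
    _ = t := by rw [Measure.real, h.uniform_null i hi t ht, ENNReal.toReal_ofReal ht.1]

lemma variance_card_entriesLE_le (t : ℝ) :
    Var[fun ω => (#(entriesLE I₀ (fun i => p i ω) t) : ℝ); P] ≤ m := by
  set X : Fin m → Ω → ℝ := fun i ω => (Set.Iic t).indicator 1 (p i ω)
  have h1 : Measurable ((Set.Iic t).indicator (1 : ℝ → ℝ)) :=
    measurable_one.indicator measurableSet_Iic
  have hindep : Set.Pairwise (I₀ : Set (Fin m)) fun i k => IndepFun (X i) (X k) P :=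
    fun i hi k hk hik => (h.indep_null.indepFun (i := ⟨i, hi⟩) (j := ⟨k, hk⟩)
      (by simpa using hik)).comp h1 h1
  have hvar (i : Fin m) : Var[X i; P] ≤ 1 := by
    refine (variance_le_sq_of_bounded (a := 0) (b := 1) (.of_forall fun ω => ?_)
      (h.memLp_indicator i t).aemeasurable).trans (by norm_num)
    by_cases hω : p i ω ≤ t <;> simp [hω]
  calc Var[fun ω => (#(entriesLE I₀ (fun i => p i ω) t) : ℝ); P] = Var[∑ i ∈ I₀, X i; P] := by
        congr 1
        ext ω
        simp [X, natCast_card_entriesLE]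
    _ = ∑ i ∈ I₀, Var[X i; P] := IndepFun.variance_sum (fun i _ => h.memLp_indicator i t) hindep
    _ ≤ #I₀ • 1 := Finset.sum_le_card_nsmul _ _ _ fun i _ => hvar i
    _ ≤ m := by simpa using I₀.card_le_univ

end BasicIndependence

lemma tendstoZeroInProb_card_entriesLE_div {Ω : ℕ → Type*} [∀ m, MeasurableSpace (Ω m)]
    {P : ∀ m, Measure (Ω m)} [∀ m, IsProbabilityMeasure (P m)] {I₀ : ∀ m, Finset (Fin m)}
    {p : ∀ m, Fin m → Ω m → ℝ} (hBI : ∀ m, BasicIndependence (P m) (I₀ m) (p m))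
    {κ₀ t : ℝ} (hκ₀ : Tendsto (fun m : ℕ => (#(I₀ m) : ℝ) / m) atTop (𝓝 κ₀))
    (ht : t ∈ Set.Icc 0 1) :
    TendstoZeroInProb P fun m ω =>
      (#(entriesLE (I₀ m) (fun i => p m i ω) t) : ℝ) / m - t * κ₀ := by
  set V : ∀ m, Ω m → ℝ := fun m ω => #(entriesLE (I₀ m) (fun i => p m i ω) t)
  have hV (m) : Measurable (V m) :=
    (measurable_card_entriesLE measurable_const).comp (hBI m).measurable_vec
  have hVm (m ω) : |V m ω / m| ≤ 1 := by
    rw [abs_of_nonneg (by positivity)]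
    refine div_le_one_of_le₀ ?_ (Nat.cast_nonneg m)
    exact Nat.cast_le.2 (card_entriesLE_le _ t)
  have hE (m) : ∫ ω, V m ω / m ∂P m = t * (#(I₀ m) / m) := by
    rw [integral_div, (hBI m).integral_card_entriesLE ht, mul_div_assoc]
  have hVar (m : ℕ) : Var[fun ω => V m ω / m; P m] ≤ (m : ℝ)⁻¹ := by
    simp_rw [div_eq_inv_mul]
    rw [variance_const_mul]
    calc (m : ℝ)⁻¹ ^ 2 * Var[V m; P m] ≤ (m : ℝ)⁻¹ ^ 2 * m := by
          gcongr
          exact (hBI m).variance_card_entriesLE_le t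
      _ = (m : ℝ)⁻¹ := by simpa [sq] using mul_self_mul_inv (m : ℝ)⁻¹
  have hLLN : TendstoZeroInProb P fun m ω => V m ω / m - ∫ ω', V m ω' / m ∂P m :=
    (tendstoZeroInProb_sub_integral_iff (.of_forall fun m => (hV m).div_const _)
      (.of_forall fun m => .of_forall (hVm m))).2 <|
      squeeze_zero (fun m => variance_nonneg _ _) hVar tendsto_inv_atTop_nhds_zero_nat
  simp_rw [hE] at hLLN
  exact hLLN.sub_const (hκ₀.const_mul t)

end LawOfLargeNumbers

section Asymptotics

variable {α lam κ : ℝ} {g : ℕ → (Set.Ici lam → ℝ) → ℝ} {I₀ : ∀ m, Finset (Fin m)}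
  {μ : ∀ m, Measure (Fin m → ℝ)}

lemma tendstoZeroInProb_condFDP_mul_est_div
    (hM : ∀ᶠ m in atTop, AdaptiveModel α lam (g m) (I₀ m) (μ m))
    (hV : TendstoZeroInProb μ fun m x => (#(entriesLE (I₀ m) x lam) : ℝ) / m - κ) :
    TendstoZeroInProb μ fun m x =>
      condFDP α lam (g m) (I₀ m) x * (g m (ecdfTail lam x) / m) - α / lam * κ := by
  obtain ⟨m, h⟩ := hM.exists
  refine (hV.const_mul (div_pos h.alpha_pos h.lam_pos)).of_imp fun ε hε => ⟨ε, hε, ?_⟩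
  filter_upwards [hM] with m h
  filter_upwards [h.admissible] with x hx hε
  rwa [← mul_div_assoc, hx.condFDP_mul_est h.lam_pos.ne', mul_div_assoc, ← mul_sub] at hε

variable [∀ m, IsProbabilityMeasure (μ m)]

lemma tendsto_integral_condFDP_mul_rate
    (hM : ∀ᶠ m in atTop, AdaptiveModel α lam (g m) (I₀ m) (μ m)) (hκ : 0 < κ)
    (hV : TendstoZeroInProb μ fun m x => (#(entriesLE (I₀ m) x lam) : ℝ) / m - κ) :
    Tendsto (fun m => ∫ x, condFDP α lam (g m) (I₀ m) x * rate α lam (g m) x ∂μ m)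
      atTop (𝓝 0) := by
  simp_rw [condFDP_mul_rate]
  have hsq : ∀ᶠ m in atTop, ∀ᵐ x ∂μ m, |condFDP α lam (g m) (I₀ m) x ^ 2| ≤ 1 := by
    filter_upwards [hM] with m h
    filter_upwards [h.ae_condFDP_le_one] with x hx
    rw [abs_pow]
    exact pow_le_one₀ (abs_nonneg _) hx
  refine ((hV.tendstoInftyInProb_of_div_natCast hκ).div_tendstoZeroInProb hsq).tendsto_integral
    (C := 1) ?_ ?_
  · filter_upwards [hM] with m h
    have := h.measurable_est
    fun_prop
  · filter_upwards [hsq] with m h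
    filter_upwards [h] with x hx using (abs_div_natCast_le _ _).trans hx

lemma tendsto_variance_FDP_iff
    (hM : ∀ᶠ m in atTop, AdaptiveModel α lam (g m) (I₀ m) (μ m)) (hκ : 0 < κ)
    (hV : TendstoZeroInProb μ fun m x => (#(entriesLE (I₀ m) x lam) : ℝ) / m - κ) :
    Tendsto (fun m => Var[FDP α lam (g m) (I₀ m); μ m]) atTop (𝓝 0) ↔
      Tendsto (fun m => Var[condFDP α lam (g m) (I₀ m); μ m]) atTop (𝓝 0) ∧
      Tendsto (fun m => ∫ x, condFDP α lam (g m) (I₀ m) x /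
        rejectionsOne α lam (g m) (I₀ m) x ∂μ m) atTop (𝓝 0) := by
  have hrate := tendsto_integral_condFDP_mul_rate hM hκ hV
  have hvar : ∀ᶠ m in atTop, _ := hM.mono fun m h => h.variance_FDP
  rw [tendsto_congr' hvar]
  refine ⟨fun h => ?_, fun ⟨hcond, hdiv⟩ => by simpa using hcond.add (hdiv.sub hrate)⟩
  have hle : ∀ᶠ m in atTop, 0 ≤
      ∫ x, condFDP α lam (g m) (I₀ m) x / rejectionsOne α lam (g m) (I₀ m) x ∂μ m -
        ∫ x, condFDP α lam (g m) (I₀ m) x * rate α lam (g m) x ∂μ m :=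
    hM.mono fun m h => sub_nonneg.2 h.integral_condFDP_mul_rate_le
  refine ⟨squeeze_zero' (.of_forall fun m => variance_nonneg _ _)
    (hle.mono fun m => le_add_of_nonneg_right) h, ?_⟩
  have hdiff := squeeze_zero' hle
    (.of_forall fun m => le_add_of_nonneg_left (variance_nonneg _ _)) h
  simpa using hdiff.add hrate

lemma tendsto_integral_condFDP_div_rejectionsOne_iff
    (hM : ∀ᶠ m in atTop, AdaptiveModel α lam (g m) (I₀ m) (μ m)) :
    Tendsto (fun m => ∫ x, condFDP α lam (g m) (I₀ m) x /
        rejectionsOne α lam (g m) (I₀ m) x ∂μ m) atTop (𝓝 0) ↔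
      TendstoZeroInProb μ fun m x => condFDP α lam (g m) (I₀ m) x /
        rejectionsOne α lam (g m) (I₀ m) x := by
  refine (tendstoZeroInProb_iff_tendsto_integral (C := 1) ?_ ?_ ?_).symm
  · filter_upwards [hM] with m h
    exact (measurable_condFDP h.measurable_est).div (measurable_rejectionsOne h.measurable_est)
  · filter_upwards [hM] with m h
    filter_upwards [h.ae_condFDP_mem_Icc] with x hx using div_nonneg hx.1 (Nat.cast_nonneg _)
  · filter_upwards [hM] with m h
    filter_upwards [h.ae_condFDP_le_one] with x hx using (abs_div_natCast_le _ _).trans hx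

theorem tendstoZeroInProb_FDP_sub_integral_iff
    (hM : ∀ᶠ m in atTop, AdaptiveModel α lam (g m) (I₀ m) (μ m)) (hκ : 0 < κ)
    (hV : TendstoZeroInProb μ fun m x => (#(entriesLE (I₀ m) x lam) : ℝ) / m - κ) {K : ℝ}
    (hK : 0 < K) (hest : ∀ᶠ m in atTop, ∀ᵐ x ∂μ m, g m (ecdfTail lam x) / m ≤ K) :
    TendstoZeroInProb μ (fun m x => FDP α lam (g m) (I₀ m) x -
        ∫ y, FDP α lam (g m) (I₀ m) y ∂μ m) ↔
      TendstoZeroInProb μ (fun m x => g m (ecdfTail lam x) / m -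
        ∫ y, g m (ecdfTail lam y) / m ∂μ m) ∧
      TendstoInftyInProb μ (fun m x => (rejectionsOne α lam (g m) (I₀ m) x : ℝ)) := by
  obtain ⟨m, h⟩ := hM.exists
  have hc : 0 < α / lam * κ := mul_pos (div_pos h.alpha_pos h.lam_pos) hκ
  have hg : ∀ᶠ m in atTop, Measurable (g m) := hM.mono fun m h => h.measurable_est
  have hest_div : ∀ᶠ m in atTop, ∀ᵐ x ∂μ m,
      0 ≤ g m (ecdfTail lam x) / m ∧ g m (ecdfTail lam x) / m ≤ K := by
    filter_upwards [hM, hest] with m h hest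
    filter_upwards [h.admissible, hest] with x hx hxK
    exact ⟨div_nonneg hx.est_pos.le (Nat.cast_nonneg m), hxK⟩
  have hcond := hM.mono fun m h => h.ae_condFDP_mem_Icc
  have hcond_abs := hM.mono fun m h => h.ae_condFDP_le_one
  have hprod := tendstoZeroInProb_condFDP_mul_est_div hM hV
  rw [tendstoZeroInProb_sub_integral_iff (hg.mono fun m hg => measurable_FDP hg)
      (hM.mono fun m h => h.ae_FDP_le_one), tendsto_variance_FDP_iff hM hκ hV,
    ← tendstoZeroInProb_sub_integral_iff (hg.mono fun m hg => measurable_condFDP hg) hcond_abs,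
    tendsto_integral_condFDP_div_rejectionsOne_iff hM]
  constructor
  · rintro ⟨hcondE, hdiv⟩
    exact ⟨hprod.sub_integral_of_mul hc hK hcondE (hcond.mono fun m h => h.mono fun x hx => hx.1)
        (hg.mono fun m hg => by fun_prop) hest_div,
      hdiv.tendstoInftyInProb_of_div (by positivity) (hprod.tendsto_measure_lt_of_mul hc hK
        (hcond.mono fun m h => h.mono fun x hx => hx.1) hest) (hM.mono fun m h =>
          h.ae_rejectionsOne_pos)⟩
  · rintro ⟨hestE, hR⟩
    simp_rw [mul_comm (condFDP _ _ _ _ _)] at hprod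
    exact ⟨hprod.sub_integral_of_mul hc one_pos hestE
        (hest_div.mono fun m h => h.mono fun x hx => hx.1)
        (hg.mono fun m hg => measurable_condFDP hg) hcond,
      hR.div_tendstoZeroInProb hcond_abs⟩

end Asymptotics

lemma BasicIndependence.adaptiveModel {Ω : Type*} [MeasurableSpace Ω] {P : Measure Ω}
    [IsProbabilityMeasure P] {I₀ : Finset (Fin m)} {p : Fin m → Ω → ℝ} {α lam : ℝ}
    {g : (Set.Ici lam → ℝ) → ℝ} (h : BasicIndependence P I₀ p) (hα : 0 < α) (hlam₀ : 0 < lam)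
    (hlam₁ : lam ≤ 1) (hg : Measurable g) (hg_pos : ∀ ω, 0 < g (ecdfTail lam fun i => p i ω))
    (hg_count : ∀ ω, countLE (fun i => p i ω) lam ≤
      lam / α * g (ecdfTail lam fun i => p i ω)) :
    AdaptiveModel α lam g I₀ (P.map fun ω i => p i ω) where
  alpha_pos := hα
  lam_pos := hlam₀
  lam_le_one := hlam₁
  measurable_est := hg
  uniform _ hi := h.isUniformCoord hi
  admissible := by
    rw [ae_map_iff h.measurable_vec.aemeasurable (measurableSet_admissible hg)]
    refine .of_forall fun ω => ⟨fun i => (h.mem_Icc i ω).1, hg_pos ω, ?_⟩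
    rw [← countLE_eq_card, ← le_div_iff₀ hα, mul_div_right_comm]
    exact hg_count ω

end

end MultipleTesting

open MultipleTesting in
open scoped Finset in
theorem theorem4p2_general
    {Ω : ℕ → Type*} [∀ m, MeasurableSpace (Ω m)]
    (P : ∀ m, Measure (Ω m)) [∀ m, IsProbabilityMeasure (P m)]
    (I₀ : ∀ m, Finset (Fin m)) (p : ∀ m, Fin m → Ω m → ℝ)
    (hBI : ∀ m, BasicIndependence (P m) (I₀ m) (p m))
    (α lam : ℝ) (hα : 0 < α) (hlam₀ : 0 < lam) (hlam₁ : lam ≤ 1)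
    (g : ∀ _ : ℕ, (Set.Ici lam → ℝ) → ℝ) (hg : ∀ m, Measurable (g m))
    (m0hat : ∀ m, Ω m → ℝ)
    (hm0hat : ∀ m ω, m0hat m ω = g m (ecdfTail lam (fun i => p m i ω)))
    (κ₀ : ℝ) (hκ₀ : 0 < κ₀)
    (hA1 : Tendsto (fun m : ℕ => ((I₀ m).card : ℝ) / m) atTop (𝓝 κ₀))
    (hA2pos : ∀ m, 1 ≤ m → ∀ ω, 0 < m0hat m ω)
    (hA2 : ∀ m, 1 ≤ m → ∀ ω, countLE (fun i => p m i ω) lam ≤ lam / α * m0hat m ω)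
    (K : ℝ) (hK : 0 < K) (hA3 : ∀ m : ℕ, 1 ≤ m → ∀ ω, m0hat m ω ≤ K * m) :
    TendstoZeroInProb P (fun m ω => FDP α lam (g m) (I₀ m) (fun i => p m i ω)
        - ∫ ω', FDP α lam (g m) (I₀ m) (fun i => p m i ω') ∂(P m)) ↔
      (TendstoZeroInProb P (fun m ω => m0hat m ω / m - ∫ ω', m0hat m ω' / m ∂(P m)) ∧
      TendstoInftyInProb P (fun m ω =>
        (rejectionsOne α lam (g m) (I₀ m) (fun i => p m i ω) : ℝ))) := by
  have hT (m) : Measurable fun ω i => p m i ω := (hBI m).measurable_vec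
  have _ (m) : IsProbabilityMeasure ((P m).map fun ω i => p m i ω) :=
    Measure.isProbabilityMeasure_map (hT m).aemeasurable
  have hest (m) : Measurable fun x : Fin m → ℝ => g m (ecdfTail lam x) / m := by fun_prop
  simp only [hm0hat] at hA2pos hA2 hA3 ⊢
  have hM : ∀ᶠ m in atTop,
      AdaptiveModel α lam (g m) (I₀ m) ((P m).map fun ω i => p m i ω) := by
    filter_upwards [eventually_ge_atTop 1] with m hm
    exact (hBI m).adaptiveModel hα hlam₀ hlam₁ (hg m) (hA2pos m hm) (hA2 m hm)
  have hK_ae : ∀ᶠ m in atTop, ∀ᵐ x ∂(P m).map fun ω i => p m i ω,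
      g m (ecdfTail lam x) / m ≤ K := by
    filter_upwards [eventually_ge_atTop 1] with m hm
    rw [ae_map_iff (hT m).aemeasurable (measurableSet_le (hest m) measurable_const)]
    exact .of_forall fun ω => div_le_of_le_mul₀ (Nat.cast_nonneg m) hK.le (hA3 m hm ω)
  have hV : TendstoZeroInProb (fun m => (P m).map fun ω i => p m i ω)
      fun m x => (#(entriesLE (I₀ m) x lam) : ℝ) / m - lam * κ₀ :=
    (tendstoZeroInProb_map_iff hT fun m => by fun_prop).2
      (tendstoZeroInProb_card_entriesLE_div hBI hA1 ⟨hlam₀.le, hlam₁⟩)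
  rw [← tendstoZeroInProb_map_sub_integral_iff hT fun m => measurable_FDP (hg m),
    ← tendstoZeroInProb_map_sub_integral_iff hT hest,
    ← tendstoInftyInProb_map_iff hT fun m => measurable_rejectionsOne (hg m)]
  exact tendstoZeroInProb_FDP_sub_integral_iff hM (mul_pos hlam₀ hκ₀) hV hK hK_ae

theorem theorem4p2
    {Ω : ℕ → Type*} [∀ m, MeasurableSpace (Ω m)]
    (P : ∀ m, Measure (Ω m)) [∀ m, IsProbabilityMeasure (P m)]
    (I₀ : ∀ m, Finset (Fin m)) (p : ∀ m, Fin m → Ω m → ℝ)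
    (hBI : ∀ m, MultipleTesting.BasicIndependence (P m) (I₀ m) (p m))
    (α lam : ℝ) (hα : 0 < α) (hαlam : α ≤ lam) (hlam : lam < 1)
    -- the estimator of the number of true nulls is `g m` of the empirical distribution function
    -- restricted to `[lam, ∞)`
    (g : ∀ _ : ℕ, (Set.Ici lam → ℝ) → ℝ) (hg : ∀ m, Measurable (g m))
    (m0hat : ∀ m, Ω m → ℝ)
    (hm0hat : ∀ m ω, m0hat m ω = g m (MultipleTesting.ecdfTail lam (fun i => p m i ω)))
    -- (A1)
    (κ₀ : ℝ) (hκ₀ : 0 < κ₀)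
    (hA1 : Tendsto (fun m : ℕ => ((I₀ m).card : ℝ) / m) atTop (𝓝 κ₀))
    -- (A2)
    (hA2pos : ∀ m, 1 ≤ m → ∀ ω, 0 < m0hat m ω)
    (hA2 : ∀ m, 1 ≤ m → ∀ ω,
      MultipleTesting.countLE (fun i => p m i ω) lam ≤ lam / α * m0hat m ω)
    -- (A3)
    (K : ℝ) (hK : 0 < K) (hA3 : ∀ m : ℕ, 1 ≤ m → ∀ ω, m0hat m ω ≤ K * m) :
    MultipleTesting.TendstoZeroInProb P (fun m ω =>
        MultipleTesting.FDP α lam (g m) (I₀ m) (fun i => p m i ω)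
          - ∫ ω', MultipleTesting.FDP α lam (g m) (I₀ m) (fun i => p m i ω') ∂(P m))
    ↔
    (MultipleTesting.TendstoZeroInProb P (fun m ω =>
        m0hat m ω / m - ∫ ω', m0hat m ω' / m ∂(P m)) ∧
      MultipleTesting.TendstoInftyInProb P (fun m ω =>
        (MultipleTesting.rejectionsOne α lam (g m) (I₀ m) (fun i => p m i ω) : ℝ))) :=
  theorem4p2_general P I₀ p hBI α lam hα (hα.trans_le hαlam) hlam.le g hg m0hat hm0hat κ₀ hκ₀ hA1
    hA2pos hA2 K hK hA3
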